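/- \textbf{Setting.} Let $N_1,\dots,N_p$ be non-empty compact smooth manifolds without boundary, $\dim N_q=m_q$, with smooth Riemannian metrics $g_{N_q}$, let $N=\prod_q N_q$ carry the product metric, with volume $|N|$, and let $0<\lambda\le\infty$. Let $M=[0,\lambda)\times N$ carry the multiply warped product metric $g=dr^2+\sum_{q}s_q(r)^2g_{N_q}$, where the $s_q\ge 0$ are continuous on $[0,\lambda)$ and $A(r):=\prod_q s_q(r)^{m_q}$ is positive for $0<r<\lambda$. Let $a,c$ be functions on $[0,\lambda)$, positive on $(0,\lambda)$, such that $cA$ is integrable on $[0,r]$ for every $r<\lambda$, and put $$\widetilde v(r)=\int_0^r c(t)A(t)\,dt,\qquad \widetilde V(r)=|N|\,\widetilde v(r),\qquad \mathrm{Vol}_c(\Omega)=\int_\Omega c(r)\,dv_g,\qquad B_R=\{r<R\},\qquad \psi=aA .$$ Say that the \emph{isoperimetric property with weights} $(a,c)$ holds if for every relatively compact open set $\Omega\subset M$ whose boundary (in $M$) is a graph $\partial\Omega=\{(\rho(\theta),\theta):\theta\in N\}$ of a Lipschitz function $\rho:N\to[0,\lambda)$, there is exactly one $R\in[0,\lambda)$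 with $\mathrm{Vol}_c(B_R)=\mathrm{Vol}_c(\Omega)$, the boundary of $\widetilde\Omega^\#:=B_R$ is $\{r=R\}$, $$\int_{\partial\Omega}a(r)\,dS\;\ge\;\int_{\partial\widetilde\Omega^\#}a(r)\,dS ,$$ and, if all $N_q$ are connected, equality holds if and only if $\partial\Omega$ is a coordinate slice $\{r=r_0\}$. (No monotonicity of $\psi$ or of the $s_q$ is assumed.) \textbf{Theorem.} \begin{enumerate} \item If $\psi\circ\widetilde V^{-1}$ is convex on $\widetilde V([0,\lambda))$, then the isoperimetric property with weights $(a,c)$ holds. \item In particular, if $A\circ v^{-1}$ is convex on $v([0,\lambda))$, where $v(r)=\int_0^rA(t)\,dt$, then the isoperimetric property with weights $(1,1)$ holds, that is, $|\partial\Omega|\ge|\partial\Omega^\#|$, where $\Omega^\#=B_R$ has the same volume as $\Omega$. \item Suppose that all $s_q$ are equal to one function $s$ (so that $g=dr^2+s(r)^2g_N$), twice differentiable on $(0,\lambda)$. If $\sum_q m_q\ge 1$, then $A\circ v^{-1}$ is convex if and only if $ss''-s'^2\ge 0$ on $(0,\lambda)$. If $ss''-s'^2\ge0$ on $(0,\lambda)$,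 then the isoperimetric property with weights $(1,1)$ holds. \end{enumerate} -/

import Mathlib

open MeasureTheory Set Topology
open scoped Manifold ContDiff ENNReal

namespace WarpedIso

noncomputable section

/-- A smooth Riemannian metric on the `n`-dimensional manifold `X`. -/
abbrev RiemMetric (n : ℕ) (X : Type*) [TopologicalSpace X]
    [ChartedSpace (EuclideanSpace ℝ (Fin n)) X] [IsManifold (𝓡 n) ∞ X] :=
  Bundle.ContMDiffRiemannianMetric (𝓡 n) ∞ (EuclideanSpace ℝ (Fin n))
    (fun x : X => TangentSpace (𝓡 n) x)

section RiemannianVolume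

variable {n : ℕ} {X : Type*} [TopologicalSpace X]
  [ChartedSpace (EuclideanSpace ℝ (Fin n)) X] [IsManifold (𝓡 n) ∞ X]

/-- The matrix `(g_ij)` of the metric `g` in the preferred chart around `x`, at the point with
coordinates `y`. -/
def coordMatrix (g : RiemMetric n X) (x : X) (y : EuclideanSpace ℝ (Fin n)) :
    Matrix (Fin n) (Fin n) ℝ :=
  Matrix.of fun i j =>
    g.inner ((extChartAt (𝓡 n) x).symm y)
      (mfderiv 𝓘(ℝ, EuclideanSpace ℝ (Fin n)) (𝓡 n) (extChartAt (𝓡 n) x).symm y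
        (EuclideanSpace.single i (1 : ℝ)))
      (mfderiv 𝓘(ℝ, EuclideanSpace ℝ (Fin n)) (𝓡 n) (extChartAt (𝓡 n) x).symm y
        (EuclideanSpace.single j (1 : ℝ)))

/-- The Riemannian volume `√(det g_ij) dy` in the domain of the preferred chart around `x`,
as a measure on `X` (which vanishes outside of that domain). -/
def chartVolume [MeasurableSpace X] (g : RiemMetric n X) (x : X) : Measure X :=
  ((volume.withDensity fun y => ENNReal.ofReal (Real.sqrt (coordMatrix g x y).det)).restrict
    (extChartAt (𝓡 n) x).target).map (extChartAt (𝓡 n) x).symm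

/-- The Riemannian volume measure. The local volumes agree on the overlaps of the
chart domains, and their supremum in the lattice of measures is the measure that restricts to each
of them. -/
def riemannianVolume [MeasurableSpace X] (g : RiemMetric n X) : Measure X :=
  ⨆ x : X, chartVolume g x

end RiemannianVolume

/-- The density of the volume of the bilinear form `h` relative to the volume of the inner product
`h₀`, on a vector space with basis `b`: the value `√(det h(b_i,b_j) / det h₀(b_i,b_j))`, which is
the same for all bases. -/
def relDensity {κ T : Type*} [Fintype κ] [DecidableEq κ] (b : κ → T) (h₀ h : T → T → ℝ) : ℝ :=
  Real.sqrt ((Matrix.of fun i j => h (b i) (b j)).det / (Matrix.of fun i j => h₀ (b i) (b j)).det)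

/-- The interval `[0, lam)`, where `lam` may be `∞`. -/
def radii (lam : EReal) : Set ℝ := {r | 0 ≤ r ∧ (r : EReal) < lam}

/-- The product manifold `M = [0, lam) × ∏ N_q`. -/
abbrev Warped {p : ℕ} (lam : EReal) (N : Fin p → Type*) : Type _ := radii lam × (∀ q, N q)

/-- The function `A(r) = ∏ s_q(r)^{m_q}`. -/
def areaFactor {p : ℕ} (m : Fin p → ℕ) (s : Fin p → ℝ → ℝ) (r : ℝ) : ℝ := ∏ q, s q r ^ m q

/-- The function `∫_0^r c(t) A(t) dt`. -/
def radialVolume {p : ℕ} (m : Fin p → ℕ) (s : Fin p → ℝ → ℝ) (c : ℝ → ℝ) (r : ℝ) : ℝ :=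
  ∫ t in (0 : ℝ)..r, c t * areaFactor m s t

/-- The function `f ∘ w⁻¹` is convex, where `w` is regarded as a function on `[0, lam)` and `w⁻¹` is
defined on its range. -/
def ConvexAlong (lam : EReal) (f w : ℝ → ℝ) : Prop :=
  ConvexOn ℝ (w '' radii lam) (f ∘ Function.invFunOn w (radii lam))

section Geometry

variable {p : ℕ} {m : Fin p → ℕ} {N : Fin p → Type*} {lam : EReal}
  [∀ q, TopologicalSpace (N q)] [∀ q, ChartedSpace (EuclideanSpace ℝ (Fin (m q))) (N q)]
  [∀ q, IsManifold (𝓡 (m q)) ∞ (N q)] [∀ q, MeasurableSpace (N q)]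

/-- The tangent space of `N = ∏ N_q`. -/
abbrev BaseTangent (m : Fin p → ℕ) [∀ q, ChartedSpace (EuclideanSpace ℝ (Fin (m q))) (N q)]
    (θ : ∀ q, N q) : Type _ :=
  ∀ q, TangentSpace (𝓡 (m q)) (θ q)

/-- The coordinate basis of the tangent space of `N = ∏ N_q`. -/
def baseFrame (θ : ∀ q, N q) (k : Σ q, Fin (m q)) : BaseTangent m θ :=
  Pi.single (M := fun q => EuclideanSpace ℝ (Fin (m q))) k.1 (EuclideanSpace.single k.2 (1 : ℝ))

/-- The product metric `∑ g_q` on `N = ∏ N_q`. -/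
def baseMetric (g : ∀ q, RiemMetric (m q) (N q)) (θ : ∀ q, N q) (v w : BaseTangent m θ) : ℝ :=
  ∑ q, (g q).inner (θ q) (v q) (w q)

/-- The Riemannian volume of `N = ∏ N_q`. -/
def baseVolume (g : ∀ q, RiemMetric (m q) (N q)) : Measure (∀ q, N q) :=
  Measure.pi fun q => riemannianVolume (g q)

/-- The warped product metric `dr² + ∑ s_q(r)² g_q` at the point `(r, θ)`, applied to tangent vectors
in `ℝ × T_θ N`. -/
def warpedMetric (g : ∀ q, RiemMetric (m q) (N q)) (s : Fin p → ℝ → ℝ) (r : ℝ) (θ : ∀ q, N q)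
    (v w : ℝ × BaseTangent m θ) : ℝ :=
  v.1 * w.1 + ∑ q, s q r ^ 2 * (g q).inner (θ q) (v.2 q) (w.2 q)

/-- The coordinate basis of the tangent space of `M`. -/
def warpedFrame (θ : ∀ q, N q) (k : Unit ⊕ (Σ q, Fin (m q))) : ℝ × BaseTangent m θ :=
  Sum.elim (fun _ => (1, 0)) (fun j => (0, baseFrame θ j)) k

/-- The volume measure of the warped product metric on `M`, given by its density with respect to
the volume of the product metric `dr² + ∑ g_q`. -/
def warpedVolume (lam : EReal) (g : ∀ q, RiemMetric (m q) (N q)) (s : Fin p → ℝ → ℝ) :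
    Measure (Warped lam N) :=
  ((Measure.comap (Subtype.val : radii lam → ℝ) volume).prod (baseVolume g)).withDensity fun x =>
    ENNReal.ofReal (relDensity (warpedFrame (m := m) x.2)
      (warpedMetric g (fun _ _ => 1) x.1 x.2) (warpedMetric g s x.1 x.2))

/-- The weighted volume `∫_Ω c(r) dv_g`. -/
def weightedVolume (g : ∀ q, RiemMetric (m q) (N q)) (s : Fin p → ℝ → ℝ) (c : ℝ → ℝ)
    (Ω : Set (Warped lam N)) : ℝ≥0∞ :=
  ∫⁻ x in Ω, ENNReal.ofReal (c x.1) ∂warpedVolume lam g s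

/-- The region `B_R = {r < R}`. -/
def ball (N : Fin p → Type*) (R : radii lam) : Set (Warped lam N) := {x | x.1 < R}

/-- The graph `{r = ρ(θ)}` over `N`. -/
def radialGraph (ρ : (∀ q, N q) → radii lam) : Set (Warped lam N) := {x | x.1 = ρ x.2}

/-- `ρ` is Lipschitz near every point of `N`, in local coordinates. -/
def IsLipschitz (m : Fin p → ℕ) [∀ q, ChartedSpace (EuclideanSpace ℝ (Fin (m q))) (N q)]
    (ρ : (∀ q, N q) → ℝ) : Prop :=
  ∀ θ, ∃ K, ∃ t ∈ 𝓝 (extChartAt (ModelWithCorners.pi fun q => 𝓡 (m q)) θ θ),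
    LipschitzOnWith K (ρ ∘ (extChartAt (ModelWithCorners.pi fun q => 𝓡 (m q)) θ).symm) t

/-- The differential of `ρ : N → ℝ`. -/
def radialDiff (ρ : (∀ q, N q) → ℝ) (θ : ∀ q, N q) (v : BaseTangent m θ) : ℝ :=
  mfderiv (ModelWithCorners.pi fun q => 𝓡 (m q)) 𝓘(ℝ, ℝ) ρ θ v

/-- The pull-back of the warped product metric to `N` under `F(θ) = (ρ(θ), θ)`, whose differential is
`v ↦ (dρ(v), v)`. -/
def inducedMetric (g : ∀ q, RiemMetric (m q) (N q)) (s : Fin p → ℝ → ℝ) (ρ : (∀ q, N q) → ℝ)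
    (θ : ∀ q, N q) (v w : BaseTangent m θ) : ℝ :=
  warpedMetric g s (ρ θ) θ (radialDiff ρ θ v, v) (radialDiff ρ θ w, w)

/-- The integral `∫_Σ a(r) dS` over the hypersurface `Σ = {r = ρ(θ)}`, where `dS` is the volume of
the metric that the warped product metric induces on `Σ`, written in the parametrization
`θ ↦ (ρ(θ), θ)`. -/
def surfaceIntegral (g : ∀ q, RiemMetric (m q) (N q)) (s : Fin p → ℝ → ℝ) (a : ℝ → ℝ)
    (ρ : (∀ q, N q) → radii lam) : ℝ≥0∞ :=
  ∫⁻ θ, ENNReal.ofReal (a (ρ θ)) * ENNReal.ofReal (relDensity (baseFrame (m := m) θ)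
    (baseMetric g θ) (inducedMetric g s (fun η => (ρ η : ℝ)) θ)) ∂baseVolume g

/-- The isoperimetric inequality for the weights `a` (on hypersurfaces) and `c` (on regions), among
relatively compact open sets `Ω` whose boundary is the graph of a Lipschitz function `ρ` over `N`:
there is exactly one `B_R` with the weighted volume of `Ω`, its boundary is the slice `{r = R}`, the
weighted area of `∂Ω` is at least that of `∂B_R`, and (for connected `N`) equality holds if and only
if `∂Ω` is a coordinate slice. -/
def StarShapedIsoperimetric (lam : EReal) (g : ∀ q, RiemMetric (m q) (N q))
    (s : Fin p → ℝ → ℝ) (a c : ℝ → ℝ) : Prop :=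
  ∀ (Ω : Set (Warped lam N)) (ρ : (∀ q, N q) → radii lam),
    IsOpen Ω → IsCompact (closure Ω) → IsLipschitz m (fun θ => (ρ θ : ℝ)) →
    frontier Ω = radialGraph ρ →
    ∃ R : radii lam,
      (∀ R' : radii lam,
        weightedVolume g s c (ball N R') = weightedVolume g s c Ω ↔ R' = R) ∧
      frontier (ball N R) = radialGraph (fun _ => R) ∧
      surfaceIntegral g s a (fun _ => R) ≤ surfaceIntegral g s a ρ ∧
      ((∀ q, ConnectedSpace (N q)) →
        (surfaceIntegral g s a ρ = surfaceIntegral g s a (fun _ => R) ↔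
          ∃ r₀ : radii lam, frontier Ω = radialGraph (fun _ => r₀)))

end Geometry

end

end WarpedIso

/-!
The idea is to compare a radial graph with the slices point by point, and then to apply Jensen's
inequality on `N`.

A relatively compact open set `Ω` whose boundary is the graph of `ρ` is the region below this graph
(`eq_subgraph_of_frontier_eq`), so that integration along the fibres gives
`Vol_c(Ω) = ∫_N v(ρ)` with `v(r) = ∫_0^r c A` (`weightedVolume_subgraph`). Since `v` is continuous
and strictly increasing, there is exactly one `R` with `|N| v(R) = ∫_N v(ρ)`.

The metric induced on the graph at `θ` is `dρ ⊗ dρ + ∑ s_q(ρ)² g_q`. By the matrix determinant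
lemma, adding the square `dρ ⊗ dρ` does not decrease the determinant, so that the area density is at least
`A(ρ)`, and where `A(ρ) > 0`, the two are equal only if `dρ = 0` (`areaFactor_le_relDensity`,
`radialDiff_eq_zero_of_relDensity_eq`). With `ψ = a A`, the weighted area of the graph is thus at
least `∫_N ψ(ρ)`. Convexity of `ψ` as a function of the volume provides a line that supports it at
`R` (`ConvexAlong.exists_support`). Integrated over `N`, its slope term vanishes by the choice
of `R`, and what is left is `|N| ψ(R)`, the weighted area of the slice `{r = R}`
(`starShapedIsoperimetric_of_convexAlong`).

In the case of equality, `dρ = 0` almost everywhere on `{ρ > 0}`. A Lipschitz function with almost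
everywhere vanishing differential is locally constant
(`eventually_eq_of_lipschitzOnWith_of_ae_hasFDerivAt_zero`), so that the level set of `ρ` through a
point where `ρ > 0` is open and closed, and it is all of `N` if `N` is connected.

These arguments use that the Riemannian volume is finite, positive on open sets, and has the same
null sets as Lebesgue measure in each chart. All of this follows from the change of variables
formula, by which the local volumes agree on the overlaps of charts (`riemannianVolume_apply_of_subset`,
`restrict_target_absolutelyContinuous`).

For a single warping function `σ` and `M = ∑ m_q`, the derivative of `A = σ ^ M` with respect to `v`
is `M σ' / σ`. This is monotone if and only if `σ σ'' - σ'² ≥ 0` (`convexAlong_pow_iff`).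
-/

namespace WarpedIso

/-! ### Radial functions and convexity along a reparametrization -/

section Radial

variable {lam : EReal}

instance ordConnected_radii : OrdConnected (radii lam) :=
  ⟨fun _ hx _ hy _ hz =>
    ⟨hx.1.trans hz.1, (EReal.coe_le_coe_iff.2 hz.2).trans_lt hy.2⟩⟩

theorem mem_radii_of_le {r t : ℝ} (hr : r ∈ radii lam) (ht : 0 ≤ t) (htr : t ≤ r) :
    t ∈ radii lam :=
  ⟨ht, (EReal.coe_le_coe_iff.2 htr).trans_lt hr.2⟩

theorem Icc_subset_radii {r : ℝ} (hr : r ∈ radii lam) : Icc 0 r ⊆ radii lam :=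
  fun _ ht => mem_radii_of_le hr ht.1 ht.2

theorem exists_gt_mem_radii {r : ℝ} (hr : r ∈ radii lam) : ∃ t ∈ radii lam, r < t := by
  obtain ⟨q, hq, hq'⟩ := EReal.lt_iff_exists_real_btwn.1 hr.2
  exact ⟨q, ⟨hr.1.trans (EReal.coe_lt_coe_iff.1 hq).le, hq'⟩, EReal.coe_lt_coe_iff.1 hq⟩

theorem radii_mem_nhds {r : ℝ} (hr : r ∈ radii lam) (h0 : 0 < r) : radii lam ∈ 𝓝 r := by
  obtain ⟨t, ht, hrt⟩ := exists_gt_mem_radii hr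
  filter_upwards [Ioo_mem_nhds h0 hrt] with x hx using mem_radii_of_le ht hx.1.le hx.2.le

theorem measurableSet_radii : MeasurableSet (radii lam) :=
  ordConnected_radii.measurableSet

/-- Convexity of `f ∘ w⁻¹` for an increasing homeomorphism `w`, expressed through difference
quotients of `f` with respect to `w`. -/
theorem convexAlong_iff_slope {f w : ℝ → ℝ} (hw : StrictMonoOn w (radii lam))
    (hc : ContinuousOn w (radii lam)) :
    ConvexAlong lam f w ↔ ∀ x ∈ radii lam, ∀ z ∈ radii lam, ∀ y, x < y → y < z →
      (f y - f x) / (w y - w x) ≤ (f z - f y) / (w z - w y) := by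
  have hinv : ∀ r ∈ radii lam, Function.invFunOn w (radii lam) (w r) = r := fun r hr =>
    hw.injOn.leftInvOn_invFunOn hr
  have hconv : Convex ℝ (w '' radii lam) :=
    ((ordConnected_radii.isPreconnected.image w hc).ordConnected).convex
  rw [ConvexAlong, convexOn_iff_slope_mono_adjacent]
  constructor
  · rintro ⟨-, h⟩ x hx z hz y hxy hyz
    have hy : y ∈ radii lam := ordConnected_radii.out hx hz ⟨hxy.le, hyz.le⟩
    simpa [hinv x hx, hinv y hy, hinv z hz] using
      h (mem_image_of_mem w hx) (mem_image_of_mem w hz) (hw hx hy hxy) (hw hy hz hyz)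
  · refine fun h => ⟨hconv, ?_⟩
    rintro _ b _ ⟨x, hx, rfl⟩ ⟨z, hz, rfl⟩ hxb hbz
    obtain ⟨y, hy, rfl⟩ : b ∈ w '' radii lam :=
      hconv.ordConnected.out (mem_image_of_mem w hx) (mem_image_of_mem w hz) ⟨hxb.le, hbz.le⟩
    simpa [hinv x hx, hinv y hy, hinv z hz] using
      h x hx z hz y ((hw.lt_iff_lt hx hy).1 hxb) ((hw.lt_iff_lt hy hz).1 hbz)

theorem ConvexAlong.const_mul {f w : ℝ → ℝ} (hw : StrictMonoOn w (radii lam))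
    (hc : ContinuousOn w (radii lam)) (h : ConvexAlong lam f w) {k : ℝ} (hk : 0 < k) :
    ConvexAlong lam f (fun r => k * w r) := by
  rw [convexAlong_iff_slope (fun x hx y hy hxy => mul_lt_mul_of_pos_left (hw hx hy hxy) hk)
    (continuousOn_const.mul hc)]
  intro x hx z hz y hxy hyz
  have := (convexAlong_iff_slope hw hc).1 h x hx z hz y hxy hyz
  simp only [← mul_sub, div_mul_eq_div_div_swap]
  exact div_le_div_of_nonneg_right this hk.le

/-- A function that is convex along `w` has a supporting line at each positive radius. -/
theorem ConvexAlong.exists_support {f w : ℝ → ℝ} (hw : StrictMonoOn w (radii lam))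
    (hc : ContinuousOn w (radii lam)) (h : ConvexAlong lam f w) {R : ℝ} (hR : R ∈ radii lam)
    (h0 : 0 < R) : ∃ k, ∀ r ∈ radii lam, f R + k * (w r - w R) ≤ f r := by
  rw [convexAlong_iff_slope hw hc] at h
  obtain ⟨T, hT, hRT⟩ := exists_gt_mem_radii hR
  set S := (fun x => (f R - f x) / (w R - w x)) '' Ico 0 R
  have hne : S.Nonempty := ⟨_, mem_image_of_mem _ (left_mem_Ico.2 h0)⟩
  have hub : ∀ z ∈ radii lam, R < z → (f z - f R) / (w z - w R) ∈ upperBounds S := by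
    rintro z hz hRz _ ⟨x, hx, rfl⟩
    exact h x (mem_radii_of_le hR hx.1 hx.2.le) z hz R hx.2 hRz
  refine ⟨sSup S, fun r hr => ?_⟩
  rcases lt_trichotomy r R with hlt | rfl | hgt
  · have h1 := le_csSup ⟨_, hub T hT hRT⟩ (mem_image_of_mem _ (show r ∈ Ico 0 R from ⟨hr.1, hlt⟩))
    rw [div_le_iff₀ (sub_pos.2 (hw hr hR hlt))] at h1
    linarith
  · simp
  · have h1 := csSup_le hne (hub r hr hgt)
    rw [le_div_iff₀ (sub_pos.2 (hw hR hr hgt))] at h1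
    linarith

theorem ConvexAlong.continuousOn {f w : ℝ → ℝ} (hw : StrictMonoOn w (radii lam))
    (hc : ContinuousOn w (radii lam)) (h : ConvexAlong lam f w) :
    ContinuousOn f {r | r ∈ radii lam ∧ 0 < r} := by
  have hmaps : MapsTo w {r | r ∈ radii lam ∧ 0 < r} (interior (w '' radii lam)) := by
    rintro r ⟨hr, h0⟩
    obtain ⟨T, hT, hrT⟩ := exists_gt_mem_radii hr
    have hz : (0 : ℝ) ∈ radii lam := mem_radii_of_le hr le_rfl hr.1
    rw [mem_interior_iff_mem_nhds]
    filter_upwards [Ioo_mem_nhds (hw hz hr h0) (hw hr hT hrT)] with y hy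
    exact h.1.ordConnected.out (mem_image_of_mem w hz) (mem_image_of_mem w hT) ⟨hy.1.le, hy.2.le⟩
  refine ((ConvexOn.continuousOn_interior h).comp (hc.mono fun r hr => hr.1) hmaps).congr ?_
  intro r hr
  simp only [Function.comp_apply]
  rw [hw.injOn.leftInvOn_invFunOn hr.1]

end Radial

section RadialVolume

variable {lam : EReal} {k : ℝ → ℝ}

theorem strictMonoOn_primitive
    (hk : ∀ r ∈ radii lam, IntervalIntegrable k volume 0 r)
    (hpos : ∀ r ∈ radii lam, 0 < r → 0 < k r) :
    StrictMonoOn (fun r => ∫ t in (0 : ℝ)..r, k t) (radii lam) := by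
  intro x hx y hy hxy
  have hint : IntervalIntegrable k volume x y := (hk x hx).symm.trans (hk y hy)
  have := intervalIntegral.intervalIntegral_pos_of_pos_on hint
    (fun t ht => hpos t (mem_radii_of_le hy (hx.1.trans ht.1.le) ht.2.le) (hx.1.trans_lt ht.1)) hxy
  rw [← intervalIntegral.integral_interval_sub_left (hk y hy) (hk x hx)] at this
  simpa using this

theorem continuousOn_primitive_radii
    (hk : ∀ r ∈ radii lam, IntervalIntegrable k volume 0 r) :
    ContinuousOn (fun r => ∫ t in (0 : ℝ)..r, k t) (radii lam) := by
  intro r hr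
  obtain ⟨T, hT, hrT⟩ := exists_gt_mem_radii hr
  have h := intervalIntegral.continuousOn_primitive_interval' (hk T hT) left_mem_uIcc
  rw [uIcc_of_le hT.1] at h
  refine (h r ⟨hr.1, hrT.le⟩).mono_of_mem_nhdsWithin ?_
  filter_upwards [self_mem_nhdsWithin, mem_nhdsWithin_of_mem_nhds (Iio_mem_nhds hrT)] with t ht ht'
  exact ⟨ht.1, le_of_lt ht'⟩

theorem hasDerivAt_primitive (hc : ContinuousOn k (radii lam)) {r : ℝ} (hr : r ∈ radii lam)
    (h0 : 0 < r) : HasDerivAt (fun r => ∫ t in (0 : ℝ)..r, k t) (k r) r := by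
  have hnh := radii_mem_nhds hr h0
  refine intervalIntegral.integral_hasDerivAt_right ?_ ?_ (hc.continuousAt hnh)
  · exact (hc.mono (by rw [uIcc_of_le hr.1]; exact Icc_subset_radii hr)).intervalIntegrable
  · exact ⟨radii lam, hnh, hc.aestronglyMeasurable measurableSet_radii⟩

theorem intervalIntegrable_of_continuousOn_radii (hc : ContinuousOn k (radii lam)) :
    ∀ r ∈ radii lam, IntervalIntegrable k volume 0 r := fun r hr =>
  (hc.mono (by rw [uIcc_of_le hr.1]; exact Icc_subset_radii hr)).intervalIntegrable

/-- For `A = σ ^ M`, the function `A ∘ v⁻¹` with `v' = A` has derivative `M σ' / σ`, so that it is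
convex if and only if `σ` is logarithmically convex. -/
theorem convexAlong_pow_iff {σ : ℝ → ℝ} {M : ℕ} (hM : 0 < M) (hσ : ContinuousOn σ (radii lam))
    (hpos : ∀ r ∈ radii lam, 0 < r → 0 < σ r)
    (hd : ∀ r ∈ radii lam, 0 < r → DifferentiableAt ℝ σ r ∧ DifferentiableAt ℝ (deriv σ) r) :
    ConvexAlong lam (fun r => σ r ^ M) (fun r => ∫ t in (0 : ℝ)..r, σ t ^ M) ↔
      ∀ r ∈ radii lam, 0 < r → 0 ≤ σ r * deriv (deriv σ) r - deriv σ r ^ 2 := by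
  set v := fun r => ∫ t in (0 : ℝ)..r, σ t ^ M with hv
  have hAc : ContinuousOn (fun r => σ r ^ M) (radii lam) := hσ.pow M
  have hint := intervalIntegrable_of_continuousOn_radii hAc
  have hmono : StrictMonoOn v (radii lam) :=
    strictMonoOn_primitive hint fun r hr h0 => pow_pos (hpos r hr h0) M
  have hvc : ContinuousOn v (radii lam) := continuousOn_primitive_radii hint
  have hM' : (0 : ℝ) < M := by exact_mod_cast hM
  have hvd : ∀ r ∈ radii lam, 0 < r → HasDerivAt v (σ r ^ M) r := fun r hr h0 =>
    hasDerivAt_primitive hAc hr h0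
  have hAd : ∀ r ∈ radii lam, 0 < r →
      HasDerivAt (fun r => σ r ^ M) (M * σ r ^ (M - 1) * deriv σ r) r := fun r hr h0 =>
    (hd r hr h0).1.hasDerivAt.pow M
  have hquot : ∀ r ∈ radii lam, 0 < r →
      M * σ r ^ (M - 1) * deriv σ r / σ r ^ M = M * (deriv σ r / σ r) := fun r hr h0 => by
    have := hpos r hr h0
    obtain ⟨n, rfl⟩ := Nat.exists_eq_succ_of_ne_zero hM.ne'
    simp only [Nat.succ_eq_add_one, Nat.add_sub_cancel, pow_succ]
    field_simp
  have hrd : ∀ r ∈ radii lam, 0 < r → HasDerivAt (fun r => deriv σ r / σ r)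
      ((deriv (deriv σ) r * σ r - deriv σ r * deriv σ r) / σ r ^ 2) r := fun r hr h0 =>
    (hd r hr h0).2.hasDerivAt.div (hd r hr h0).1.hasDerivAt (hpos r hr h0).ne'
  set I := {r | r ∈ radii lam ∧ 0 < r} with hI
  have hIo : IsOpen I := isOpen_iff_mem_nhds.2 fun r hr =>
    Filter.inter_mem (radii_mem_nhds hr.1 hr.2) (Ioi_mem_nhds hr.2)
  have hIc : OrdConnected I := ordConnected_radii.inter ordConnected_Ioi
  have key : ConvexAlong lam (fun r => σ r ^ M) v ↔ MonotoneOn (fun r => deriv σ r / σ r) I := by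
    rw [convexAlong_iff_slope hmono hvc]
    constructor
    · intro h
      have hslope : ∀ r ∈ I, Filter.Tendsto (fun t => (σ t ^ M - σ r ^ M) / (v t - v r)) (𝓝[≠] r)
          (𝓝 (M * (deriv σ r / σ r))) := fun r hr => by
        rw [← hquot r hr.1 hr.2]
        have h1 := ((hAd r hr.1 hr.2).tendsto_slope).div ((hvd r hr.1 hr.2).tendsto_slope)
          (pow_pos (hpos r hr.1 hr.2) M).ne'
        refine h1.congr' ?_
        filter_upwards [self_mem_nhdsWithin] with t ht
        have : t - r ≠ 0 := sub_ne_zero.2 ht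
        simp only [Pi.div_apply, slope_def_field]
        rw [div_div_div_cancel_right₀ this]
      intro x hx y hy hxy
      rcases hxy.eq_or_lt with rfl | hxy
      · exact le_rfl
      refine le_of_mul_le_mul_left ?_ hM'
      trans (σ y ^ M - σ x ^ M) / (v y - v x)
      · refine le_of_tendsto ((hslope x hx).mono_left (nhdsLT_le_nhdsNE x)) ?_
        filter_upwards [Ioo_mem_nhdsLT hx.2] with t ht
        have := h t (mem_radii_of_le hx.1 ht.1.le ht.2.le) y hy.1 x ht.2 hxy
        rwa [← neg_sub (σ x ^ M), ← neg_sub (v x), neg_div_neg_eq]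
      · obtain ⟨T, hT, hyT⟩ := exists_gt_mem_radii hy.1
        refine ge_of_tendsto ((hslope y hy).mono_left (nhdsGT_le_nhdsNE y)) ?_
        filter_upwards [Ioo_mem_nhdsGT hyT] with t ht
        exact h x hx.1 t (mem_radii_of_le hT (hy.1.1.trans ht.1.le) ht.2.le) y hxy ht.1
    · intro h x hx z hz y hxy hyz
      have mvt : ∀ a ∈ radii lam, ∀ b ∈ radii lam, a < b → ∃ c ∈ Ioo a b,
          (σ b ^ M - σ a ^ M) / (v b - v a) = M * (deriv σ c / σ c) := fun a ha b hb hab => by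
        have hsub : Icc a b ⊆ radii lam := ordConnected_radii.out ha hb
        have hsub' : ∀ c ∈ Ioo a b, c ∈ I := fun c hc =>
          ⟨hsub ⟨hc.1.le, hc.2.le⟩, ha.1.trans_lt hc.1⟩
        obtain ⟨c, hc, h2⟩ := exists_ratio_hasDerivAt_eq_ratio_slope (fun r => σ r ^ M) _ hab
          (hAc.mono hsub) (fun c hc => hAd c (hsub' c hc).1 (hsub' c hc).2) v _
          (hvc.mono hsub) (fun c hc => hvd c (hsub' c hc).1 (hsub' c hc).2)
        refine ⟨c, hc, ?_⟩
        rw [← hquot c (hsub' c hc).1 (hsub' c hc).2, div_eq_div_iff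
          (sub_pos.2 (hmono ha hb hab)).ne' (pow_pos (hpos c (hsub' c hc).1 (hsub' c hc).2) M).ne']
        linarith
      have hy : y ∈ radii lam := ordConnected_radii.out hx hz ⟨hxy.le, hyz.le⟩
      obtain ⟨c, hc, h1⟩ := mvt x hx y hy hxy
      obtain ⟨d, hd', h2⟩ := mvt y hy z hz hyz
      rw [h1, h2]
      refine mul_le_mul_of_nonneg_left (h ?_ ?_ (hc.2.trans hd'.1).le) hM'.le
      · exact ⟨mem_radii_of_le hy (hx.1.trans hc.1.le) hc.2.le, hx.1.trans_lt hc.1⟩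
      · exact ⟨mem_radii_of_le hz (hy.1.trans hd'.1.le) hd'.2.le, hy.1.trans_lt hd'.1⟩
  rw [key]
  constructor
  · intro h r hr h0
    have h1 := h.derivWithin_nonneg (x := r)
    rw [derivWithin_of_isOpen hIo ⟨hr, h0⟩, (hrd r hr h0).deriv] at h1
    have h2 := pow_pos (hpos r hr h0) 2
    rw [div_nonneg_iff] at h1
    rcases h1 with h1 | h1
    · linarith [h1.1]
    · linarith [h1.2]
  · intro h
    refine monotoneOn_of_deriv_nonneg hIc.convex
      (fun r hr => (hrd r hr.1 hr.2).continuousAt.continuousWithinAt) ?_ ?_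
    · rw [hIo.interior_eq]
      exact fun r hr => (hrd r hr.1 hr.2).differentiableAt.differentiableWithinAt
    · rw [hIo.interior_eq]
      intro r hr
      rw [(hrd r hr.1 hr.2).deriv]
      have := h r hr.1 hr.2
      exact div_nonneg (by linarith) (sq_nonneg _)

end RadialVolume

/-! ### Determinants of Gram matrices -/

section Gram

variable {κ : Type*} [Fintype κ] {T : Type*} [AddCommGroup T] [Module ℝ T]

theorem posDef_gram (b : Module.Basis κ ℝ T) (B : LinearMap.BilinForm ℝ T)
    (hsymm : ∀ v w, B v w = B w v) (hpos : ∀ v, v ≠ 0 → 0 < B v v) :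
    (Matrix.of fun i j => B (b i) (b j)).PosDef := by
  refine Matrix.PosDef.of_dotProduct_mulVec_pos ?_ fun x hx => ?_
  · ext i j
    simp [hsymm (b i)]
  · have h1 : ∑ i, x i • b i ≠ 0 := fun h0 =>
      hx (funext fun i => Fintype.linearIndependent_iff.1 b.linearIndependent x h0 i)
    have h2 := hpos _ h1
    simp only [map_sum, LinearMap.sum_apply, map_smul, LinearMap.smul_apply, smul_eq_mul] at h2
    refine h2.trans_eq ?_
    simp only [dotProduct, Matrix.mulVec, Matrix.of_apply, Pi.star_apply, star_trivial,
      Finset.mul_sum]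
    refine Finset.sum_congr rfl fun i _ => Finset.sum_congr rfl fun j _ => ?_
    rw [hsymm (b i)]
    ring

variable [DecidableEq κ]

open Matrix in
theorem posDef_diagonal_mul_mul {G : Matrix κ κ ℝ} (hG : G.PosDef) {t : κ → ℝ}
    (ht : ∏ k, t k ≠ 0) : (diagonal t * G * diagonal t).PosDef := by
  have hinj : Function.Injective (diagonal t).mulVec := by
    rw [Matrix.mulVec_injective_iff_isUnit, Matrix.isUnit_iff_isUnit_det, det_diagonal]
    exact isUnit_iff_ne_zero.2 ht
  simpa [diagonal_conjTranspose] using hG.conjTranspose_mul_mul_same hinj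

open Matrix in
theorem det_diagonal_mul_mul (G : Matrix κ κ ℝ) (t : κ → ℝ) :
    (diagonal t * G * diagonal t).det = (∏ k, t k) ^ 2 * G.det := by
  rw [det_mul, det_mul, det_diagonal]
  ring

open Matrix in
theorem det_add_vecMulVec_of_posDef {H : Matrix κ κ ℝ} (hH : H.PosDef) (d : κ → ℝ) :
    (H + vecMulVec d d).det = H.det * (1 + d ⬝ᵥ (H⁻¹ *ᵥ d)) := by
  rw [vecMulVec_eq Unit,
    det_add_replicateCol_mul_replicateRow (isUnit_iff_ne_zero.2 hH.det_pos.ne'),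
    det_unique (n := Unit),
    Matrix.add_apply, Matrix.one_apply_eq, Matrix.mul_assoc]
  rfl

/-- Adding a square `d ⊗ d` to a scaled positive definite matrix does not decrease the
determinant. -/
theorem le_det_add_vecMulVec {G : Matrix κ κ ℝ} (hG : G.PosDef) (t d : κ → ℝ) :
    (∏ k, t k) ^ 2 * G.det ≤
      (Matrix.diagonal t * G * Matrix.diagonal t + Matrix.vecMulVec d d).det := by
  by_cases ht : ∏ k, t k = 0
  · rw [ht]
    have h1 : (Matrix.diagonal t * G * Matrix.diagonal t).PosSemidef := by
      simpa [Matrix.diagonal_conjTranspose] using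
        hG.posSemidef.conjTranspose_mul_mul_same (Matrix.diagonal t)
    have h2 : (Matrix.vecMulVec d d).PosSemidef := by
      simpa using Matrix.posSemidef_vecMulVec_self_star d
    simpa using (h1.add h2).det_nonneg
  · have hH := posDef_diagonal_mul_mul hG ht
    rw [det_add_vecMulVec_of_posDef hH, ← det_diagonal_mul_mul]
    have h1 : 0 ≤ d ⬝ᵥ ((Matrix.diagonal t * G * Matrix.diagonal t)⁻¹.mulVec d) := by
      simpa using hH.inv.posSemidef.dotProduct_mulVec_nonneg d
    nlinarith [hH.det_pos]

/-- The case of equality in `le_det_add_vecMulVec`, by the matrix determinant lemma. -/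
theorem eq_zero_of_det_add_vecMulVec {G : Matrix κ κ ℝ} (hG : G.PosDef) {t d : κ → ℝ}
    (ht : ∏ k, t k ≠ 0)
    (h : (Matrix.diagonal t * G * Matrix.diagonal t + Matrix.vecMulVec d d).det =
      (∏ k, t k) ^ 2 * G.det) : d = 0 := by
  have hH := posDef_diagonal_mul_mul hG ht
  rw [det_add_vecMulVec_of_posDef hH, ← det_diagonal_mul_mul] at h
  by_contra hd
  have h1 : 0 < d ⬝ᵥ ((Matrix.diagonal t * G * Matrix.diagonal t)⁻¹.mulVec d) := by
    simpa using hH.inv.dotProduct_mulVec_pos hd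
  nlinarith [hH.det_pos]

theorem det_gram_comp (b : Module.Basis κ ℝ T) (B : LinearMap.BilinForm ℝ T) (L : T →ₗ[ℝ] T) :
    (Matrix.of fun i j => B (L (b i)) (L (b j))).det =
      LinearMap.det L ^ 2 * (Matrix.of fun i j => B (b i) (b j)).det := by
  have h1 : (Matrix.of fun i j => B (b i) (b j)) = LinearMap.BilinForm.toMatrix b B := by
    ext i j; simp [LinearMap.BilinForm.toMatrix_apply]
  have h2 : (Matrix.of fun i j => B (L (b i)) (L (b j))) =
      LinearMap.BilinForm.toMatrix b (B.comp L L) := by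
    ext i j; simp [LinearMap.BilinForm.toMatrix_apply]
  rw [h1, h2, LinearMap.BilinForm.toMatrix_comp b b, Matrix.det_mul, Matrix.det_mul,
    Matrix.det_transpose, LinearMap.det_toMatrix]
  ring

/-- The relative density does not depend on the basis. -/
theorem relDensity_comp (b : Module.Basis κ ℝ T) (B₀ B : LinearMap.BilinForm ℝ T) (L : T →ₗ[ℝ] T)
    (hL : LinearMap.det L ≠ 0) :
    relDensity (fun k => L (b k)) (fun v w => B₀ v w) (fun v w => B v w) =
      relDensity b (fun v w => B₀ v w) (fun v w => B v w) := by
  unfold relDensity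
  rw [det_gram_comp, det_gram_comp, mul_div_mul_left _ _ (pow_ne_zero 2 hL)]

end Gram

section WarpForm

variable {p : ℕ} {m : Fin p → ℕ}

/-- The coordinate basis of `∏ ℝ^{m_q}`. -/
noncomputable def productFrame (m : Fin p → ℕ) :
    Module.Basis (Σ q, Fin (m q)) ℝ (∀ q, EuclideanSpace ℝ (Fin (m q))) :=
  Pi.basis fun q => (EuclideanSpace.basisFun (Fin (m q)) ℝ).toBasis

theorem productFrame_apply (k : Σ q, Fin (m q)) :
    productFrame m k = Pi.single (M := fun q => EuclideanSpace ℝ (Fin (m q))) k.1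
      (EuclideanSpace.single k.2 (1 : ℝ)) := by
  simp [productFrame, Pi.basis_apply]

/-- The bilinear form `d ⊗ d + ∑ t_q² γ_q` on `∏ ℝ^{m_q}`. -/
noncomputable def warpForm
    (γ : ∀ q, EuclideanSpace ℝ (Fin (m q)) →L[ℝ] EuclideanSpace ℝ (Fin (m q)) →L[ℝ] ℝ)
    (t : Fin p → ℝ) (d : (∀ q, EuclideanSpace ℝ (Fin (m q))) →ₗ[ℝ] ℝ) :
    LinearMap.BilinForm ℝ (∀ q, EuclideanSpace ℝ (Fin (m q))) :=
  LinearMap.mk₂ ℝ (fun v w => d v * d w + ∑ q, t q ^ 2 * γ q (v q) (w q))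
    (fun v v' w => by
      simp only [map_add, Pi.add_apply, add_apply, mul_add,
        Finset.sum_add_distrib]
      ring)
    (fun c v w => by
      simp only [map_smul, Pi.smul_apply, smul_apply, smul_eq_mul, mul_add,
        Finset.mul_sum, mul_assoc, mul_left_comm])
    (fun v w w' => by
      simp only [map_add, Pi.add_apply, mul_add, Finset.sum_add_distrib]
      ring)
    (fun c v w => by
      simp only [map_smul, Pi.smul_apply, smul_eq_mul, mul_add, Finset.mul_sum, mul_left_comm])

variable {γ : ∀ q, EuclideanSpace ℝ (Fin (m q)) →L[ℝ] EuclideanSpace ℝ (Fin (m q)) →L[ℝ] ℝ}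

theorem warpForm_apply (t : Fin p → ℝ) (d : (∀ q, EuclideanSpace ℝ (Fin (m q))) →ₗ[ℝ] ℝ)
    (v w : ∀ q, EuclideanSpace ℝ (Fin (m q))) :
    warpForm γ t d v w = d v * d w + ∑ q, t q ^ 2 * γ q (v q) (w q) := rfl

theorem warpForm_one_zero_apply (v w : ∀ q, EuclideanSpace ℝ (Fin (m q))) :
    warpForm γ 1 0 v w = ∑ q, γ q (v q) (w q) := by
  simp [warpForm_apply]

theorem posDef_gram_warpForm_one (hsymm : ∀ q v w, γ q v w = γ q w v)
    (hpos : ∀ q v, v ≠ 0 → 0 < γ q v v) :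
    (Matrix.of fun i j => warpForm γ 1 0 (productFrame m i) (productFrame m j)).PosDef := by
  refine posDef_gram _ _ (fun v w => ?_) fun v hv => ?_
  · simp [warpForm_apply, hsymm _ (v _)]
  · obtain ⟨q, hq⟩ := Function.ne_iff.1 hv
    have h0 : ∀ q, 0 ≤ γ q (v q) (v q) := fun q => by
      rcases eq_or_ne (v q) 0 with h | h
      · simp [h]
      · exact (hpos q _ h).le
    simpa [warpForm_apply] using
      Finset.sum_pos' (fun q _ => h0 q) ⟨q, Finset.mem_univ q, hpos q _ hq⟩

theorem gram_warpForm (t : Fin p → ℝ) (d : (∀ q, EuclideanSpace ℝ (Fin (m q))) →ₗ[ℝ] ℝ) :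
    (Matrix.of fun i j => warpForm γ t d (productFrame m i) (productFrame m j)) =
      Matrix.diagonal (fun k : Σ q, Fin (m q) => t k.1) *
          (Matrix.of fun i j => warpForm γ 1 0 (productFrame m i) (productFrame m j)) *
          Matrix.diagonal (fun k => t k.1) +
        Matrix.vecMulVec (fun k => d (productFrame m k)) (fun k => d (productFrame m k)) := by
  ext i j
  have h1 : ∑ q, t q ^ 2 * γ q (productFrame m i q) (productFrame m j q) =
      t i.1 * (∑ q, γ q (productFrame m i q) (productFrame m j q)) * t j.1 := by
    rw [Finset.mul_sum, Finset.sum_mul]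
    refine Finset.sum_congr rfl fun q _ => ?_
    -- both coordinate vectors vanish off their own factor
    by_cases hi : q = i.1
    · by_cases hj : q = j.1
      · rw [← hi, ← hj]; ring
      · simp [productFrame_apply j, Pi.single_eq_of_ne hj]
    · simp [productFrame_apply i, Pi.single_eq_of_ne hi]
  simp [warpForm_apply, Matrix.vecMulVec_apply, h1, add_comm]

theorem prod_sigma_fst (t : Fin p → ℝ) :
    ∏ k : Σ q, Fin (m q), t k.1 = ∏ q, t q ^ m q := by
  simp [Fintype.prod_sigma]

theorem prod_le_relDensity_warpForm (hsymm : ∀ q v w, γ q v w = γ q w v)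
    (hpos : ∀ q v, v ≠ 0 → 0 < γ q v v) (t : Fin p → ℝ)
    (d : (∀ q, EuclideanSpace ℝ (Fin (m q))) →ₗ[ℝ] ℝ) :
    ∏ q, t q ^ m q ≤ relDensity (productFrame m) (fun v w => warpForm γ 1 0 v w)
      (fun v w => warpForm γ t d v w) := by
  have hG := posDef_gram_warpForm_one hsymm hpos
  refine Real.le_sqrt_of_sq_le ?_
  rw [le_div_iff₀ hG.det_pos, gram_warpForm t d, ← prod_sigma_fst]
  exact le_det_add_vecMulVec hG _ _

theorem relDensity_warpForm_zero (hsymm : ∀ q v w, γ q v w = γ q w v)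
    (hpos : ∀ q v, v ≠ 0 → 0 < γ q v v) {t : Fin p → ℝ} (ht : ∀ q, 0 ≤ t q) :
    relDensity (productFrame m) (fun v w => warpForm γ 1 0 v w)
      (fun v w => warpForm γ t 0 v w) = ∏ q, t q ^ m q := by
  have hG := posDef_gram_warpForm_one hsymm hpos
  have h0 : Matrix.vecMulVec (fun k => (0 : (∀ q, EuclideanSpace ℝ (Fin (m q))) →ₗ[ℝ] ℝ)
      (productFrame m k)) (fun k => (0 : (∀ q, EuclideanSpace ℝ (Fin (m q))) →ₗ[ℝ] ℝ)
      (productFrame m k)) = 0 := by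
    ext i j; simp [Matrix.vecMulVec_apply]
  rw [relDensity, gram_warpForm t 0, h0, add_zero, det_diagonal_mul_mul,
    mul_div_cancel_right₀ _ hG.det_pos.ne', prod_sigma_fst, Real.sqrt_sq]
  exact Finset.prod_nonneg fun q _ => pow_nonneg (ht q) _

theorem eq_zero_of_relDensity_warpForm (hsymm : ∀ q v w, γ q v w = γ q w v)
    (hpos : ∀ q v, v ≠ 0 → 0 < γ q v v) {t : Fin p → ℝ}
    {d : (∀ q, EuclideanSpace ℝ (Fin (m q))) →ₗ[ℝ] ℝ} (ht : 0 < ∏ q, t q ^ m q)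
    (h : relDensity (productFrame m) (fun v w => warpForm γ 1 0 v w)
      (fun v w => warpForm γ t d v w) = ∏ q, t q ^ m q) : d = 0 := by
  have hG := posDef_gram_warpForm_one hsymm hpos
  rw [relDensity, Real.sqrt_eq_iff_mul_self_eq_of_pos ht, eq_div_iff hG.det_pos.ne',
    gram_warpForm t d, ← pow_two, ← prod_sigma_fst] at h
  rw [← prod_sigma_fst] at ht
  have h1 := eq_zero_of_det_add_vecMulVec hG ht.ne' h.symm
  exact (productFrame m).ext fun k => by simpa using congrFun h1 k

end WarpForm

/-! ### The metric tensor in charts -/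

section Charts

variable {n : ℕ} {X : Type*} [TopologicalSpace X]
  [ChartedSpace (EuclideanSpace ℝ (Fin n)) X]

/-- The differential of the inverse of the preferred chart around `x`. The tangent space of `X` at
the image point is identified with the model space, as it is by definition of `TangentSpace`. -/
noncomputable def chartDeriv (n : ℕ) {X : Type*} [TopologicalSpace X]
    [ChartedSpace (EuclideanSpace ℝ (Fin n)) X] (x : X) (y : EuclideanSpace ℝ (Fin n)) :
    EuclideanSpace ℝ (Fin n) →L[ℝ] EuclideanSpace ℝ (Fin n) :=
  mfderiv 𝓘(ℝ, EuclideanSpace ℝ (Fin n)) (𝓡 n) (extChartAt (𝓡 n) x).symm y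

/-- The change of coordinates from the preferred chart around `x` to the one around `x'`. -/
noncomputable def transition (n : ℕ) {X : Type*} [TopologicalSpace X]
    [ChartedSpace (EuclideanSpace ℝ (Fin n)) X] (x x' : X) :
    EuclideanSpace ℝ (Fin n) → EuclideanSpace ℝ (Fin n) :=
  extChartAt (𝓡 n) x' ∘ (extChartAt (𝓡 n) x).symm

theorem isOpen_transition_source (x x' : X) :
    IsOpen ((extChartAt (𝓡 n) x).target ∩
      (extChartAt (𝓡 n) x).symm ⁻¹' (extChartAt (𝓡 n) x').source) :=
  (continuousOn_extChartAt_symm x).isOpen_inter_preimage (isOpen_extChartAt_target x)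
    (isOpen_extChartAt_source x')

theorem injOn_transition (x x' : X) :
    InjOn (transition n x x') ((extChartAt (𝓡 n) x).target ∩
      (extChartAt (𝓡 n) x).symm ⁻¹' (extChartAt (𝓡 n) x').source) := by
  intro y hy z hz h
  exact (extChartAt (𝓡 n) x).symm.injOn hy.1 hz.1 ((extChartAt (𝓡 n) x').injOn hy.2 hz.2 h)

variable [IsManifold (𝓡 n) ∞ X]

/-- The metric `g` at `z`, as a bilinear form on the model space. -/
noncomputable def metricForm (g : RiemMetric n X) (z : X) :
    EuclideanSpace ℝ (Fin n) →L[ℝ] EuclideanSpace ℝ (Fin n) →L[ℝ] ℝ :=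
  g.inner z

theorem metricForm_symm (g : RiemMetric n X) (z : X) (v w : EuclideanSpace ℝ (Fin n)) :
    metricForm g z v w = metricForm g z w v := g.symm z v w

theorem metricForm_pos (g : RiemMetric n X) (z : X) {v : EuclideanSpace ℝ (Fin n)} (hv : v ≠ 0) :
    0 < metricForm g z v v := g.pos z v hv

theorem coordMatrix_eq (g : RiemMetric n X) (x : X) (y : EuclideanSpace ℝ (Fin n)) :
    coordMatrix g x y = Matrix.of fun i j =>
      (metricForm g ((extChartAt (𝓡 n) x).symm y)).toBilinForm
        (chartDeriv n x y ((EuclideanSpace.basisFun (Fin n) ℝ).toBasis i))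
        (chartDeriv n x y ((EuclideanSpace.basisFun (Fin n) ℝ).toBasis j)) := by
  ext i j
  simp only [OrthonormalBasis.coe_toBasis, EuclideanSpace.basisFun_apply]
  rfl

theorem mdifferentiableAt_chart_symm {x : X} {y : EuclideanSpace ℝ (Fin n)}
    (hy : y ∈ (extChartAt (𝓡 n) x).target) :
    MDifferentiableAt 𝓘(ℝ, EuclideanSpace ℝ (Fin n)) (𝓡 n) (extChartAt (𝓡 n) x).symm y := by
  have h := mdifferentiableWithinAt_extChartAt_symm (I := 𝓡 n) hy
  rwa [ModelWithCorners.range_eq_univ, mdifferentiableWithinAt_univ] at h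

theorem det_chartDeriv_ne_zero {x : X} {y : EuclideanSpace ℝ (Fin n)}
    (hy : y ∈ (extChartAt (𝓡 n) x).target) :
    LinearMap.det (chartDeriv n x y : EuclideanSpace ℝ (Fin n) →ₗ[ℝ] EuclideanSpace ℝ (Fin n))
      ≠ 0 := by
  have h := isInvertible_mfderivWithin_extChartAt_symm (I := 𝓡 n) hy
  rw [ModelWithCorners.range_eq_univ, mfderivWithin_univ] at h
  obtain ⟨L, hL⟩ := h
  let L' : EuclideanSpace ℝ (Fin n) ≃L[ℝ] EuclideanSpace ℝ (Fin n) := L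
  have h2 : chartDeriv n x y = (L' : EuclideanSpace ℝ (Fin n) →L[ℝ] EuclideanSpace ℝ (Fin n)) :=
    hL.symm
  rw [h2]
  exact L'.toLinearEquiv.isUnit_det'.ne_zero

theorem det_coordMatrix_pos (g : RiemMetric n X) {x : X} {y : EuclideanSpace ℝ (Fin n)}
    (hy : y ∈ (extChartAt (𝓡 n) x).target) : 0 < (coordMatrix g x y).det := by
  rw [coordMatrix_eq]
  refine (mul_pos ?_ ?_).trans_eq (det_gram_comp _ _ (chartDeriv n x y :
    EuclideanSpace ℝ (Fin n) →ₗ[ℝ] EuclideanSpace ℝ (Fin n))).symm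
  · exact sq_pos_of_ne_zero (det_chartDeriv_ne_zero hy)
  · exact (posDef_gram _ _ (metricForm_symm g _) fun v hv => metricForm_pos g _ hv).det_pos

/-- The coefficients of the metric in a chart are continuous. -/
theorem continuousOn_metricForm_chartDeriv (g : RiemMetric n X) (x : X)
    (v w : EuclideanSpace ℝ (Fin n)) :
    ContinuousOn (fun y => metricForm g ((extChartAt (𝓡 n) x).symm y) (chartDeriv n x y v)
      (chartDeriv n x y w)) (extChartAt (𝓡 n) x).target := by
  have hopen := isOpen_extChartAt_target (I := 𝓡 n) x
  have hframe : ∀ v : EuclideanSpace ℝ (Fin n), ContinuousOn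
      (fun y => (⟨(extChartAt (𝓡 n) x).symm y, chartDeriv n x y v⟩ : TangentBundle (𝓡 n) X))
      (extChartAt (𝓡 n) x).target := by
    intro v
    have h1 := (contMDiffOn_extChartAt_symm (I := 𝓡 n) (n := ∞) x).continuousOn_tangentMapWithin
      (by norm_num) hopen.uniqueMDiffOn
    have h2 : Continuous (fun y => (⟨y, v⟩ : TangentBundle 𝓘(ℝ, EuclideanSpace ℝ (Fin n))
        (EuclideanSpace ℝ (Fin n)))) :=
      (tangentBundleModelSpaceHomeomorph 𝓘(ℝ, EuclideanSpace ℝ (Fin n))).symm.continuous.comp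
        (Continuous.prodMk continuous_id continuous_const)
    refine (h1.comp h2.continuousOn fun y hy => hy).congr fun y hy => ?_
    simp only [Function.comp_apply, tangentMapWithin]
    rw [mfderivWithin_of_isOpen hopen hy]
    rfl
  have hmetric : ContinuousOn (fun y => Bundle.TotalSpace.mk'
      (EuclideanSpace ℝ (Fin n) →L[ℝ] EuclideanSpace ℝ (Fin n) →L[ℝ] ℝ)
      (E := fun z : X => TangentSpace (𝓡 n) z →L[ℝ] TangentSpace (𝓡 n) z →L[ℝ] ℝ)
      ((extChartAt (𝓡 n) x).symm y) (g.inner ((extChartAt (𝓡 n) x).symm y)))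
      (extChartAt (𝓡 n) x).target :=
    g.contMDiff.continuous.comp_continuousOn (continuousOn_extChartAt_symm x)
  have := ContinuousOn.clm_bundle_apply₂ (E₃ := Bundle.Trivial X ℝ) hmetric
    (hframe v) (hframe w)
  exact ((Bundle.Trivial.homeomorphProd X ℝ).continuous.comp_continuousOn this).snd

theorem continuousOn_det_coordMatrix (g : RiemMetric n X) (x : X) :
    ContinuousOn (fun y => (coordMatrix g x y).det) (extChartAt (𝓡 n) x).target := by
  simp only [Matrix.det_apply']
  exact continuousOn_finsetSum _ fun τ _ => continuousOn_const.mul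
    (continuousOn_finsetProd _ fun i _ => continuousOn_metricForm_chartDeriv g x _ _)

theorem differentiableAt_transition {x x' : X} {y : EuclideanSpace ℝ (Fin n)}
    (hy : y ∈ (extChartAt (𝓡 n) x).target)
    (hy' : (extChartAt (𝓡 n) x).symm y ∈ (extChartAt (𝓡 n) x').source) :
    DifferentiableAt ℝ (transition n x x') y := by
  have h1 : MDifferentiableAt (𝓡 n) 𝓘(ℝ, EuclideanSpace ℝ (Fin n)) (extChartAt (𝓡 n) x')
      ((extChartAt (𝓡 n) x).symm y) :=
    mdifferentiableAt_extChartAt (by rwa [extChartAt_source] at hy')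
  exact (h1.comp y (mdifferentiableAt_chart_symm hy)).differentiableAt

/-- The chain rule for the inverse charts. -/
theorem chartDeriv_eq_comp {x x' : X} {y : EuclideanSpace ℝ (Fin n)}
    (hy : y ∈ (extChartAt (𝓡 n) x).target)
    (hy' : (extChartAt (𝓡 n) x).symm y ∈ (extChartAt (𝓡 n) x').source) :
    chartDeriv n x y =
      (chartDeriv n x' (transition n x x' y)).comp (fderiv ℝ (transition n x x') y) := by
  have heq : (extChartAt (𝓡 n) x).symm =ᶠ[𝓝 y]
      (extChartAt (𝓡 n) x').symm ∘ transition n x x' := by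
    filter_upwards [(isOpen_transition_source x x').mem_nhds ⟨hy, hy'⟩] with z hz
    exact ((extChartAt (𝓡 n) x').left_inv hz.2).symm
  have h1 : MDifferentiableAt 𝓘(ℝ, EuclideanSpace ℝ (Fin n)) (𝓡 n) (extChartAt (𝓡 n) x').symm
      (transition n x x' y) := mdifferentiableAt_chart_symm ((extChartAt (𝓡 n) x').map_source hy')
  have h2 := (differentiableAt_transition hy hy').mdifferentiableAt
  have h3 := mfderiv_comp y h1 h2
  have h4 := heq.mfderiv_eq (I := 𝓘(ℝ, EuclideanSpace ℝ (Fin n))) (I' := 𝓡 n)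
  rw [mfderiv_eq_fderiv] at h3
  exact h4.trans h3

theorem det_coordMatrix_transition (g : RiemMetric n X) {x x' : X} {y : EuclideanSpace ℝ (Fin n)}
    (hy : y ∈ (extChartAt (𝓡 n) x).target)
    (hy' : (extChartAt (𝓡 n) x).symm y ∈ (extChartAt (𝓡 n) x').source) :
    (coordMatrix g x y).det =
      (fderiv ℝ (transition n x x') y).det ^ 2 *
        (coordMatrix g x' (transition n x x' y)).det := by
  have hz : (extChartAt (𝓡 n) x').symm (transition n x x' y) = (extChartAt (𝓡 n) x).symm y :=
    (extChartAt (𝓡 n) x').left_inv hy'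
  rw [coordMatrix_eq, coordMatrix_eq, hz, chartDeriv_eq_comp hy hy']
  set P := chartDeriv n x' (transition n x x' y)
  set L := fderiv ℝ (transition n x x') y
  set B := (metricForm g ((extChartAt (𝓡 n) x).symm y)).toBilinForm
  exact det_gram_comp (EuclideanSpace.basisFun (Fin n) ℝ).toBasis
    (B.comp (P : EuclideanSpace ℝ (Fin n) →ₗ[ℝ] EuclideanSpace ℝ (Fin n)) P)
    (L : EuclideanSpace ℝ (Fin n) →ₗ[ℝ] EuclideanSpace ℝ (Fin n))

end Charts

/-! ### The Riemannian volume measure -/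

theorem _root_.ContinuousOn.measurableSet_inter_preimage {α β : Type*} [TopologicalSpace α]
    [MeasurableSpace α] [OpensMeasurableSpace α] [TopologicalSpace β] [MeasurableSpace β]
    [BorelSpace β] {f : α → β} {s : Set α} {t : Set β} (hf : ContinuousOn f s)
    (hs : MeasurableSet s) (ht : MeasurableSet t) : MeasurableSet (s ∩ f ⁻¹' t) := by
  have h := hs.subtype_image ((continuousOn_iff_continuous_domRestrict.1 hf).measurable ht)
  convert h using 1
  ext x
  simp [and_comm]

section Volume

variable {n : ℕ} {X : Type*} [TopologicalSpace X]
  [ChartedSpace (EuclideanSpace ℝ (Fin n)) X] [IsManifold (𝓡 n) ∞ X]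

theorem continuousOn_chart_density (g : RiemMetric n X) (x : X) :
    ContinuousOn (fun y => ENNReal.ofReal (Real.sqrt (coordMatrix g x y).det))
      (extChartAt (𝓡 n) x).target :=
  ENNReal.continuous_ofReal.comp_continuousOn (continuousOn_det_coordMatrix g x).sqrt

variable [MeasurableSpace X]

theorem chartVolume_le_riemannianVolume (g : RiemMetric n X) (x : X) :
    chartVolume g x ≤ riemannianVolume g :=
  le_iSup (fun x => chartVolume g x) x

variable [BorelSpace X]

theorem chartVolume_apply (g : RiemMetric n X) (x : X) {B : Set X} (hB : MeasurableSet B) :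
    chartVolume g x B = ∫⁻ y in (extChartAt (𝓡 n) x).target ∩ (extChartAt (𝓡 n) x).symm ⁻¹' B,
      ENNReal.ofReal (Real.sqrt (coordMatrix g x y).det) := by
  have hT := (isOpen_extChartAt_target (I := 𝓡 n) x).measurableSet
  have hc := continuousOn_extChartAt_symm (I := 𝓡 n) x
  have hm := hc.measurableSet_inter_preimage hT hB
  rw [chartVolume, Measure.map_apply_of_aemeasurable (hc.aemeasurable hT) hB,
    Measure.restrict_apply' hT, inter_comm, withDensity_apply _ hm]

/-- The local volumes of two charts agree on the overlap, by the change of variables formula. -/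
theorem chartVolume_eq_of_subset (g : RiemMetric n X) {x x' : X} {B : Set X}
    (hB : MeasurableSet B) (hx : B ⊆ (extChartAt (𝓡 n) x).source)
    (hx' : B ⊆ (extChartAt (𝓡 n) x').source) : chartVolume g x B = chartVolume g x' B := by
  have hT := (isOpen_extChartAt_target (I := 𝓡 n) x).measurableSet
  have hm := (continuousOn_extChartAt_symm (I := 𝓡 n) x).measurableSet_inter_preimage hT hB
  have himage : (extChartAt (𝓡 n) x').target ∩ (extChartAt (𝓡 n) x').symm ⁻¹' B =
      transition n x x' '' ((extChartAt (𝓡 n) x).target ∩ (extChartAt (𝓡 n) x).symm ⁻¹' B) := by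
    ext z
    constructor
    · rintro ⟨hz, hzB⟩
      refine ⟨extChartAt (𝓡 n) x ((extChartAt (𝓡 n) x').symm z), ⟨?_, ?_⟩, ?_⟩
      · exact (extChartAt (𝓡 n) x).map_source (hx hzB)
      · rw [mem_preimage, (extChartAt (𝓡 n) x).left_inv (hx hzB)]
        exact hzB
      · rw [transition, Function.comp_apply, (extChartAt (𝓡 n) x).left_inv (hx hzB),
          (extChartAt (𝓡 n) x').right_inv hz]
    · rintro ⟨y, ⟨hy, hyB⟩, rfl⟩
      refine ⟨(extChartAt (𝓡 n) x').map_source (hx' hyB), ?_⟩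
      rw [mem_preimage, transition, Function.comp_apply, (extChartAt (𝓡 n) x').left_inv (hx' hyB)]
      exact hyB
  rw [chartVolume_apply g x hB, chartVolume_apply g x' hB, himage,
    lintegral_image_eq_lintegral_abs_det_fderiv_mul volume hm
      (f' := fun y => fderiv ℝ (transition n x x') y)
      (fun y hy => (differentiableAt_transition hy.1 (hx' hy.2)).hasFDerivAt.hasFDerivWithinAt)
      ((injOn_transition x x').mono (inter_subset_inter_right _ (preimage_mono hx')))]
  refine setLIntegral_congr_fun hm fun y hy => ?_
  rw [det_coordMatrix_transition g hy.1 (hx' hy.2), Real.sqrt_mul (sq_nonneg _),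
    Real.sqrt_sq_eq_abs, ENNReal.ofReal_mul (abs_nonneg _)]

theorem chartVolume_compl_source (g : RiemMetric n X) (x : X) :
    chartVolume g x (extChartAt (𝓡 n) x).sourceᶜ = 0 := by
  rw [chartVolume_apply g x (isOpen_extChartAt_source x).measurableSet.compl]
  have : (extChartAt (𝓡 n) x).target ∩
      (extChartAt (𝓡 n) x).symm ⁻¹' (extChartAt (𝓡 n) x).sourceᶜ = ∅ := by
    ext y
    simp only [mem_inter_iff, mem_preimage, mem_compl_iff, mem_empty_iff_false, iff_false, not_and,
      not_not]
    exact fun hy => (extChartAt (𝓡 n) x).map_target hy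
  rw [this, setLIntegral_empty]

/-- Inside the domain of a chart, the Riemannian volume is the local volume of that chart. -/
theorem riemannianVolume_apply_of_subset (g : RiemMetric n X) {x : X} {B : Set X}
    (hB : MeasurableSet B) (hx : B ⊆ (extChartAt (𝓡 n) x).source) :
    riemannianVolume g B = chartVolume g x B := by
  refine le_antisymm ?_ (chartVolume_le_riemannianVolume g x B)
  have hS := (isOpen_extChartAt_source (I := 𝓡 n) x).measurableSet
  -- a measure that dominates all local volumes, and is `chartVolume g x` on the domain of the chart
  have hle : riemannianVolume g ≤
      chartVolume g x + (riemannianVolume g).restrict (extChartAt (𝓡 n) x).sourceᶜ := by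
    refine iSup_le fun x' => Measure.le_iff.2 fun C hC => ?_
    rw [← measure_inter_add_sdiff C hS, Measure.add_apply, Measure.restrict_apply hC]
    refine add_le_add ?_ (chartVolume_le_riemannianVolume g x' _)
    have hS' := (isOpen_extChartAt_source (I := 𝓡 n) x').measurableSet
    rw [← measure_inter_add_sdiff (C ∩ _) hS', measure_mono_null
      (show (C ∩ (extChartAt (𝓡 n) x).source) \ (extChartAt (𝓡 n) x').source ⊆ _ from
        fun z hz => hz.2) (chartVolume_compl_source g x'), add_zero,
      chartVolume_eq_of_subset g ((hC.inter hS).inter hS') inter_subset_right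
        (inter_subset_left.trans inter_subset_right)]
    exact measure_mono (inter_subset_left.trans inter_subset_left)
  refine (hle B).trans_eq ?_
  rw [Measure.add_apply, Measure.restrict_apply hB]
  have : B ∩ (extChartAt (𝓡 n) x).sourceᶜ = ∅ :=
    disjoint_compl_right_iff_subset.2 hx |>.inter_eq
  rw [this, measure_empty, add_zero]

instance (g : RiemMetric n X) : IsLocallyFiniteMeasure (riemannianVolume g) := by
  refine ⟨fun x => ?_⟩
  set e := extChartAt (𝓡 n) x with he
  have hex : e x ∈ e.target := mem_extChartAt_target x
  obtain ⟨K, hK, hKT, hKc⟩ := (LocallyCompactSpace.local_compact_nhds (e x) e.target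
    ((isOpen_extChartAt_target x).mem_nhds hex))
  have hU : e.source ∩ e ⁻¹' interior K ∈ 𝓝 x :=
    ((continuousOn_extChartAt x).isOpen_inter_preimage (isOpen_extChartAt_source x)
      isOpen_interior).mem_nhds ⟨mem_extChartAt_source x, mem_interior_iff_mem_nhds.2 hK⟩
  have hUo := (continuousOn_extChartAt (I := 𝓡 n) x).isOpen_inter_preimage
    (isOpen_extChartAt_source x) (isOpen_interior (s := K))
  refine ⟨_, hU, ?_⟩
  rw [riemannianVolume_apply_of_subset g hUo.measurableSet inter_subset_left,
    chartVolume_apply g x hUo.measurableSet]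
  obtain ⟨b, hb, hbd⟩ : ∃ b : ℝ, 0 ≤ b ∧ ∀ y ∈ K, Real.sqrt (coordMatrix g x y).det ≤ b := by
    obtain ⟨b, hb⟩ := hKc.bddAbove_image ((continuousOn_det_coordMatrix g x).sqrt.mono hKT)
    exact ⟨max b 0, le_max_right _ _, fun y hy => (hb (mem_image_of_mem _ hy)).trans
      (le_max_left _ _)⟩
  calc _ ≤ ∫⁻ y in K, ENNReal.ofReal (Real.sqrt (coordMatrix g x y).det) := by
        refine lintegral_mono_set fun y hy => interior_subset ?_
        have := hy.2.2
        rwa [mem_preimage, e.right_inv hy.1] at this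
    _ ≤ ∫⁻ y in K, ENNReal.ofReal b :=
        setLIntegral_mono measurable_const fun y hy => ENNReal.ofReal_le_ofReal (hbd y hy)
    _ < ⊤ := by
        rw [setLIntegral_const]
        exact ENNReal.mul_lt_top ENNReal.ofReal_lt_top hKc.measure_lt_top

/-- A set that is null for the Riemannian volume has a null image in each chart. -/
theorem restrict_target_absolutelyContinuous (g : RiemMetric n X) (x : X) :
    (volume.restrict (extChartAt (𝓡 n) x).target) ≪
      ((riemannianVolume g).restrict (extChartAt (𝓡 n) x).source).map (extChartAt (𝓡 n) x) := by
  set e := extChartAt (𝓡 n) x with he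
  have hS := (isOpen_extChartAt_source (I := 𝓡 n) x).measurableSet
  have hT := (isOpen_extChartAt_target (I := 𝓡 n) x).measurableSet
  have hc := continuousOn_extChartAt (I := 𝓡 n) x
  refine Measure.AbsolutelyContinuous.mk fun A hA h0 => ?_
  have hm := hc.measurableSet_inter_preimage hS hA
  rw [Measure.map_apply_of_aemeasurable (hc.aemeasurable hS) hA, Measure.restrict_apply' hS,
    inter_comm, riemannianVolume_apply_of_subset g hm inter_subset_left, chartVolume_apply g x hm]
    at h0
  have hset : e.target ∩ e.symm ⁻¹' (e.source ∩ e ⁻¹' A) = A ∩ e.target := by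
    ext y
    constructor
    · rintro ⟨hy, -, hyA⟩
      rw [mem_preimage, e.right_inv hy] at hyA
      exact ⟨hyA, hy⟩
    · rintro ⟨hyA, hy⟩
      refine ⟨hy, e.map_target hy, ?_⟩
      rwa [mem_preimage, e.right_inv hy]
  rw [hset] at h0
  rw [Measure.restrict_apply hA]
  have hmeas : AEMeasurable (fun y => ENNReal.ofReal (Real.sqrt (coordMatrix g x y).det))
      (volume.restrict (A ∩ e.target)) :=
    ((continuousOn_chart_density g x).aemeasurable hT).mono_measure
      (Measure.restrict_mono inter_subset_right le_rfl)
  rw [lintegral_eq_zero_iff' hmeas, Filter.EventuallyEq, ae_restrict_iff' (hA.inter hT)] at h0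
  rw [measure_eq_zero_iff_ae_notMem]
  filter_upwards [h0] with y hy hyA
  have := hy hyA
  simp only [Pi.zero_apply, ENNReal.ofReal_eq_zero] at this
  exact absurd (Real.sqrt_pos.2 (det_coordMatrix_pos g hyA.2)) (not_lt.2 this)

instance (g : RiemMetric n X) : (riemannianVolume g).IsOpenPosMeasure := by
  refine ⟨fun U hU ⟨x, hx⟩ h0 => ?_⟩
  set e := extChartAt (𝓡 n) x with he
  have hT := isOpen_extChartAt_target (I := 𝓡 n) x
  have hS := (isOpen_extChartAt_source (I := 𝓡 n) x).measurableSet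
  have hV : IsOpen (e.target ∩ e.symm ⁻¹' U) :=
    (continuousOn_extChartAt_symm x).isOpen_inter_preimage hT hU
  have hne : (e.target ∩ e.symm ⁻¹' U).Nonempty :=
    ⟨e x, mem_extChartAt_target x, by rwa [mem_preimage, extChartAt_to_inv]⟩
  refine hV.measure_ne_zero volume hne ?_
  rw [← inter_self e.target, inter_assoc, inter_comm, ← Measure.restrict_apply hV.measurableSet]
  refine restrict_target_absolutelyContinuous g x ?_
  rw [Measure.map_apply_of_aemeasurable ((continuousOn_extChartAt x).aemeasurable hS)
    hV.measurableSet, Measure.restrict_apply' hS]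
  refine measure_mono_null ?_ h0
  rintro z ⟨⟨-, hz⟩, hzS⟩
  rwa [mem_preimage, e.left_inv hzS] at hz

end Volume

/-! ### Regions bounded by radial graphs -/

section Regions

variable {lam : EReal} {Y : Type*} [TopologicalSpace Y]

theorem isPreconnected_fibre {I : Set (radii lam)} [hI : OrdConnected I] (θ : Y) :
    IsPreconnected (I ×ˢ ({θ} : Set Y)) := by
  refine IsPreconnected.prod ?_ isPreconnected_singleton
  rw [← Topology.IsInducing.subtypeVal.isPreconnected_image]
  refine Set.OrdConnected.isPreconnected ⟨?_⟩
  rintro _ ⟨x, hx, rfl⟩ _ ⟨y, hy, rfl⟩ z hz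
  exact ⟨⟨z, ordConnected_radii.out x.2 y.2 hz⟩, hI.out hx hy hz, rfl⟩

/-- A relatively compact open set whose boundary is the graph of `ρ` is the region below this graph:
it consists of full components of the fibres, contains no unbounded one, and the set of
fibres whose lower part is missing is open. -/
theorem eq_subgraph_of_frontier_eq {ρ : Y → radii lam} (hρ : Continuous ρ)
    {Ω : Set (radii lam × Y)} (hΩ : IsOpen Ω) (hc : IsCompact (closure Ω))
    (hf : frontier Ω = {x | x.1 = ρ x.2}) : Ω = {x | x.1 < ρ x.2} := by
  have hfib : ∀ (I : Set (radii lam)) [OrdConnected I] (θ : Y), ρ θ ∉ I → ∀ r ∈ I, ∀ t ∈ I,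
      (r, θ) ∈ Ω → (t, θ) ∈ Ω := by
    intro I _ θ hI r hr t ht hrΩ
    have hfr : ∀ x ∈ I ×ˢ ({θ} : Set Y), x ∉ frontier Ω := by
      rintro ⟨u, η⟩ ⟨hu, hη⟩ huf
      obtain rfl : η = θ := hη
      rw [hf] at huf
      exact hI (huf ▸ hu)
    by_contra htΩ
    obtain ⟨x, -, hx, hx'⟩ := isPreconnected_fibre (I := I) θ Ω (closure Ω)ᶜ hΩ
      isClosed_closure.isOpen_compl
      (fun x hx => by
        by_cases h : x ∈ Ω
        · exact Or.inl h
        · exact Or.inr fun hcl => hfr x hx (hΩ.frontier_eq ▸ ⟨hcl, h⟩))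
      ⟨(r, θ), ⟨hr, rfl⟩, hrΩ⟩
      ⟨(t, θ), ⟨ht, rfl⟩, fun hcl => hfr (t, θ) ⟨ht, rfl⟩ (hΩ.frontier_eq ▸ ⟨hcl, htΩ⟩)⟩
    exact hx' (subset_closure hx)
  have hdisj : ∀ x ∈ Ω, x ∉ frontier Ω := fun x hx hxf => (hΩ.frontier_eq ▸ hxf).2 hx
  have hsub : Ω ⊆ {x | x.1 < ρ x.2} := by
    rintro ⟨r, θ⟩ hx
    by_contra hlt
    have hne : r ≠ ρ θ := fun h => hdisj _ hx (hf ▸ h)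
    have hgt : ρ θ < r := lt_of_le_of_ne (not_lt.1 hlt) hne.symm
    obtain ⟨b, -, hb⟩ := (hc.image continuous_fst).exists_isGreatest
      ⟨r, (r, θ), subset_closure hx, rfl⟩
    obtain ⟨t, ht, hbt⟩ := exists_gt_mem_radii b.2
    have hrb : r ≤ b := hb ⟨(r, θ), subset_closure hx, rfl⟩
    have hbt' : b < ⟨t, ht⟩ := hbt
    have htΩ : ((⟨t, ht⟩ : radii lam), θ) ∈ Ω :=
      hfib (Ioi (ρ θ)) θ self_notMem_Ioi r hgt _ ((hgt.trans_le hrb).trans hbt') hx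
    exact absurd (hb ⟨_, subset_closure htΩ, rfl⟩) (not_le.2 hbt')
  refine hsub.antisymm ?_
  rintro ⟨r, θ⟩ hlt
  by_contra hx
  have hcl : (r, θ) ∉ closure Ω := fun h =>
    hlt.ne (show (r, θ) ∈ {x : radii lam × Y | x.1 = ρ x.2} by
      rw [← hf, hΩ.frontier_eq]
      exact ⟨h, hx⟩)
  have h1 : ∀ᶠ η in 𝓝 θ, (r, η) ∉ Ω := by
    have h2 : ∀ᶠ y in 𝓝 (r, θ), y ∉ Ω :=
      Filter.mem_of_superset (isClosed_closure.isOpen_compl.mem_nhds hcl)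
        (compl_subset_compl.2 subset_closure)
    exact (Continuous.prodMk_right r).continuousAt.eventually h2
  have h2 : ∀ᶠ η in 𝓝 θ, r < ρ η := hρ.continuousAt.eventually (lt_mem_nhds hlt)
  have hmem : (ρ θ, θ) ∈ closure Ω := frontier_subset_closure (hf ▸ rfl)
  have hnh : ∀ᶠ y in 𝓝 (ρ θ, θ), y ∉ Ω := by
    filter_upwards [continuous_snd.continuousAt.eventually (h1.and h2)] with ⟨t, η⟩ ⟨h3, h4⟩ h5
    exact h3 (hfib (Iio (ρ η)) η self_notMem_Iio t (hsub h5) r h4 h5)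
  exact (mem_closure_iff_frequently.1 hmem) (hnh.mono fun y hy => hy)

theorem frontier_ball {p : ℕ} {N : Fin p → Type*} [∀ q, TopologicalSpace (N q)] (R : radii lam)
    (hR : 0 < (R : ℝ)) : frontier (ball N R) = radialGraph (fun _ => R) := by
  have h1 : ball N R = Prod.fst ⁻¹' Iio R := rfl
  rw [h1, ← isOpenMap_fst.preimage_frontier_eq_frontier_preimage continuous_fst,
    frontier_Iio' ⟨⟨0, mem_radii_of_le R.2 le_rfl hR.le⟩, hR⟩]
  rfl

end Regions

/-! ### Weighted volumes of subgraphs -/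

/-- Integrability on all `[0, r]` gives measurability on `[0, lam)`, a union of countably many of
these intervals. -/
theorem aemeasurable_restrict_radii {lam : EReal} {k : ℝ → ℝ}
    (hk : ∀ r ∈ radii lam, IntervalIntegrable k volume 0 r) :
    AEMeasurable k (volume.restrict (radii lam)) := by
  have hsub : radii lam ⊆ {0} ∪ ⋃ q : {q : ℚ // (q : ℝ) ∈ radii lam}, Ioc 0 ((q : ℚ) : ℝ) := by
    intro r hr
    rcases hr.1.eq_or_lt with h0 | h0
    · exact Or.inl h0.symm
    · obtain ⟨t, ht, hrt⟩ := exists_gt_mem_radii hr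
      obtain ⟨q, hq, hq'⟩ := exists_rat_btwn hrt
      exact Or.inr (mem_iUnion.2 ⟨⟨q, mem_radii_of_le ht (hr.1.trans hq.le) hq'.le⟩, h0, hq.le⟩)
  refine AEMeasurable.mono_measure ?_ (Measure.restrict_mono hsub le_rfl)
  rw [aemeasurable_union_iff, aemeasurable_iUnion_iff]
  refine ⟨?_, fun q => (hk q q.2).1.aestronglyMeasurable.aemeasurable⟩
  rw [Measure.restrict_eq_zero.2 (measure_singleton _)]
  exact aemeasurable_zero_measure

section

variable {p : ℕ} {m : Fin p → ℕ} {N : Fin p → Type*} {lam : EReal}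
  [∀ q, TopologicalSpace (N q)] [∀ q, ChartedSpace (EuclideanSpace ℝ (Fin (m q))) (N q)]

theorem baseFrame_eq (θ : ∀ q, N q) : baseFrame (m := m) θ = productFrame m := by
  funext k
  rw [productFrame_apply]
  rfl

variable [∀ q, IsManifold (𝓡 (m q)) ∞ (N q)]

/-- The metrics of all factors at `θ`, as bilinear forms on the model spaces. -/
noncomputable def metricForms (g : ∀ q, RiemMetric (m q) (N q)) (θ : ∀ q, N q) (q : Fin p) :
    EuclideanSpace ℝ (Fin (m q)) →L[ℝ] EuclideanSpace ℝ (Fin (m q)) →L[ℝ] ℝ :=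
  metricForm (g q) (θ q)

theorem metricForms_symm (g : ∀ q, RiemMetric (m q) (N q)) (θ : ∀ q, N q) (q : Fin p)
    (v w : EuclideanSpace ℝ (Fin (m q))) : metricForms g θ q v w = metricForms g θ q w v :=
  metricForm_symm (g q) (θ q) v w

theorem metricForms_pos (g : ∀ q, RiemMetric (m q) (N q)) (θ : ∀ q, N q) (q : Fin p)
    (v : EuclideanSpace ℝ (Fin (m q))) (hv : v ≠ 0) : 0 < metricForms g θ q v v :=
  metricForm_pos (g q) (θ q) hv

theorem baseMetric_eq (g : ∀ q, RiemMetric (m q) (N q)) (θ : ∀ q, N q) :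
    baseMetric g θ = fun v w => warpForm (metricForms g θ) 1 0 v w := by
  funext v w
  exact (warpForm_one_zero_apply v w).symm

theorem gram_warpedMetric (g : ∀ q, RiemMetric (m q) (N q)) (s : Fin p → ℝ → ℝ) (r : ℝ)
    (θ : ∀ q, N q) :
    (Matrix.of fun i j => warpedMetric g s r θ (warpedFrame (m := m) θ i) (warpedFrame θ j)) =
      Matrix.fromBlocks 1 0 0 (Matrix.of fun i j =>
        warpForm (metricForms g θ) (fun q => s q r) 0 (productFrame m i) (productFrame m j)) := by
  have hz : ∀ q, (g q).inner (θ q) (0 : TangentSpace (𝓡 (m q)) (θ q)) = 0 := fun q => map_zero _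
  ext (i | i) (j | j)
  · simp [warpedMetric, warpedFrame, hz]
  · simp [warpedMetric, warpedFrame, hz]
  · simp [warpedMetric, warpedFrame]
  · simp only [warpedMetric, warpedFrame, Sum.elim_inr, Matrix.of_apply, mul_zero, zero_add,
      Matrix.fromBlocks_apply₂₂, warpForm_apply, LinearMap.zero_apply, baseFrame_eq]
    rfl

theorem relDensity_warpedFrame (g : ∀ q, RiemMetric (m q) (N q)) {s : Fin p → ℝ → ℝ} {r : ℝ}
    (hs : ∀ q, 0 ≤ s q r) (θ : ∀ q, N q) :
    relDensity (warpedFrame (m := m) θ) (warpedMetric g (fun _ _ => 1) r θ)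
      (warpedMetric g s r θ) = areaFactor m s r := by
  have h := relDensity_warpForm_zero (metricForms_symm g θ) (metricForms_pos g θ)
    (t := fun q => s q r) hs
  rw [relDensity] at h ⊢
  rw [gram_warpedMetric, gram_warpedMetric, Matrix.det_fromBlocks_zero₂₁,
    Matrix.det_fromBlocks_zero₂₁, Matrix.det_one, one_mul, one_mul]
  exact h

variable [∀ q, CompactSpace (N q)] [∀ q, MeasurableSpace (N q)] [∀ q, BorelSpace (N q)]

instance (g : ∀ q, RiemMetric (m q) (N q)) : IsFiniteMeasure (baseVolume g) :=
  inferInstanceAs (IsFiniteMeasure (Measure.pi _))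

instance (g : ∀ q, RiemMetric (m q) (N q)) : (baseVolume g).IsOpenPosMeasure :=
  inferInstanceAs (Measure.pi _).IsOpenPosMeasure

instance : SigmaFinite (Measure.comap (Subtype.val : radii lam → ℝ) volume) := by
  refine SigmaFinite.of_map _ measurable_subtype_coe.aemeasurable ?_
  rw [map_comap_subtype_coe measurableSet_radii]
  infer_instance

theorem areaFactor_nonneg {s : Fin p → ℝ → ℝ} (hs : ∀ q, ∀ r ∈ radii lam, 0 ≤ s q r)
    {r : ℝ} (hr : r ∈ radii lam) : 0 ≤ areaFactor m s r :=
  Finset.prod_nonneg fun q _ => pow_nonneg (hs q r hr) _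

theorem continuousOn_areaFactor {s : Fin p → ℝ → ℝ} (hs : ∀ q, ContinuousOn (s q) (radii lam)) :
    ContinuousOn (areaFactor m s) (radii lam) :=
  continuousOn_finsetProd _ fun q _ => (hs q).pow _

theorem setLIntegral_Iio_radii {k : ℝ → ℝ}
    (hk : ∀ r ∈ radii lam, IntervalIntegrable k volume 0 r)
    (hk0 : ∀ r ∈ radii lam, 0 < r → 0 ≤ k r) (R : radii lam) :
    ∫⁻ r in Iio R, ENNReal.ofReal (k r) ∂(Measure.comap (Subtype.val : radii lam → ℝ) volume) =
      ENNReal.ofReal (∫ t in (0 : ℝ)..R, k t) := by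
  have himage : (Subtype.val : radii lam → ℝ) '' Iio R = Ico 0 (R : ℝ) := by
    ext t
    constructor
    · rintro ⟨x, hx, rfl⟩
      exact ⟨x.2.1, hx⟩
    · exact fun ht => ⟨⟨t, mem_radii_of_le R.2 ht.1 ht.2.le⟩, ht.2, rfl⟩
  rw [setLIntegral_subtype measurableSet_radii _ (fun r => ENNReal.ofReal (k r)), himage,
    setLIntegral_congr Ico_ae_eq_Ioc, intervalIntegral.integral_of_le R.2.1,
    ofReal_integral_eq_lintegral_ofReal (hk R R.2).1]
  filter_upwards [ae_restrict_mem measurableSet_Ioc] with t ht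
  exact hk0 t (mem_radii_of_le R.2 ht.1.le ht.2) ht.1

variable [∀ q, SecondCountableTopology (N q)]

/-- The weighted volume of the region below a radial graph, by integration along the fibres. -/
theorem weightedVolume_subgraph (g : ∀ q, RiemMetric (m q) (N q)) {s : Fin p → ℝ → ℝ} {c : ℝ → ℝ}
    (hs : ∀ q, ContinuousOn (s q) (radii lam)) (hs0 : ∀ q, ∀ r ∈ radii lam, 0 ≤ s q r)
    (hc : ∀ r ∈ radii lam, 0 < r → 0 < c r)
    (hint : ∀ r ∈ radii lam, IntervalIntegrable (fun t => c t * areaFactor m s t) volume 0 r)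
    {ρ : (∀ q, N q) → radii lam} (hρ : Continuous ρ) :
    weightedVolume g s c {x | x.1 < ρ x.2} =
      ∫⁻ θ, ENNReal.ofReal (radialVolume m s c (ρ θ)) ∂baseVolume g := by
  have hΩ : MeasurableSet {x : Warped lam N | x.1 < ρ x.2} :=
    measurableSet_lt measurable_fst (hρ.measurable.comp measurable_snd)
  have hdens : ∀ x : Warped lam N, relDensity (warpedFrame (m := m) x.2)
      (warpedMetric g (fun _ _ => 1) x.1 x.2) (warpedMetric g s x.1 x.2) =
      areaFactor m s x.1 := fun x =>
    relDensity_warpedFrame g (fun q => hs0 q _ x.1.2) x.2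
  have hAm : Measurable fun x : Warped lam N => ENNReal.ofReal (areaFactor m s x.1) :=
    ENNReal.measurable_ofReal.comp (((continuousOn_iff_continuous_domRestrict.1
      (continuousOn_areaFactor hs)).measurable).comp measurable_fst)
  have hkm : AEMeasurable (fun r : radii lam => ENNReal.ofReal (c r * areaFactor m s r))
      (Measure.comap Subtype.val volume) :=
    (aemeasurable_restrict_iff_comap_subtype measurableSet_radii).1
      (aemeasurable_restrict_radii hint).ennreal_ofReal
  have hA0 : ∀ r ∈ radii lam, 0 ≤ areaFactor m s r := fun r hr => areaFactor_nonneg hs0 hr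
  rw [weightedVolume, warpedVolume]
  simp only [hdens]
  rw [setLIntegral_withDensity_eq_setLIntegral_mul_non_measurable _ hAm _ hΩ
    (Filter.Eventually.of_forall fun _ => ENNReal.ofReal_lt_top), ← lintegral_indicator hΩ]
  have hmul : ((fun x : Warped lam N => ENNReal.ofReal (areaFactor m s x.1)) *
        fun x : Warped lam N => ENNReal.ofReal (c x.1)) =
      fun x => ENNReal.ofReal (c x.1 * areaFactor m s x.1) :=
    funext fun x => by rw [Pi.mul_apply, mul_comm (c _), ENNReal.ofReal_mul (hA0 _ x.1.2)]
  rw [hmul]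
  rw [lintegral_prod_symm _ (hkm.comp_fst.indicator hΩ)]
  refine lintegral_congr fun θ => ?_
  rw [radialVolume, ← setLIntegral_Iio_radii hint
    (fun r hr h0 => mul_nonneg (hc r hr h0).le (hA0 r hr)) (ρ θ),
    ← lintegral_indicator measurableSet_Iio]
  rfl

end

/-! ### Lipschitz functions with vanishing differential -/

section Lipschitz

variable {E : Type*} [NormedAddCommGroup E] [NormedSpace ℝ E] [FiniteDimensional ℝ E]
  [MeasurableSpace E] [BorelSpace E] (μ : Measure E) [μ.IsAddHaarMeasure]

/-- A Lipschitz function with almost everywhere vanishing differential is locally constant: for a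
fixed `h`, almost every segment `[x, x + h]` meets the exceptional null set in a set of measure
zero, so that `f (x + h) = f x` for almost all `x`, and then for all `x` by continuity. -/
theorem eventually_eq_of_lipschitzOnWith_of_ae_hasFDerivAt_zero {f : E → ℝ} {K : NNReal}
    {t : Set E} {x₀ : E} (hf : LipschitzOnWith K f t) (ht : t ∈ 𝓝 x₀)
    (hd : ∀ᵐ y ∂μ, y ∈ t → HasFDerivAt f (0 : E →L[ℝ] ℝ) y) : ∀ᶠ y in 𝓝 x₀, f y = f x₀ := by
  obtain ⟨r, hr, hrt⟩ := Metric.mem_nhds_iff.1 ht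
  have hcont : ∀ y ∈ Metric.ball x₀ r, ContinuousAt f y := fun y hy =>
    hf.continuousOn.continuousAt (Filter.mem_of_superset (Metric.isOpen_ball.mem_nhds hy) hrt)
  obtain ⟨Z, hZsub, hZm, hZ0⟩ := exists_measurable_superset_of_null (ae_iff.1 hd)
  have hZ : ∀ y ∉ Z, y ∈ t → HasFDerivAt f (0 : E →L[ℝ] ℝ) y := fun y hy => by
    by_contra h
    exact hy (hZsub h)
  have key : ∀ h : E, ‖h‖ < r / 2 → f (x₀ + h) = f x₀ := by
    intro h hh
    have hae : ∀ᵐ x ∂μ, ∀ᵐ τ : ℝ, x + τ • h ∉ Z := by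
      rw [Measure.ae_ae_comm (p := fun x (τ : ℝ) => x + τ • h ∉ Z)]
      · refine Filter.Eventually.of_forall fun τ => ?_
        rw [ae_iff]
        simp only [not_not]
        exact (quasiMeasurePreserving_add_right μ (τ • h)).preimage_null hZ0
      · have : Measurable fun z : E × ℝ => z.1 + z.2 • h := by fun_prop
        exact this hZm.compl
    have hseg : ∀ x ∈ Metric.ball x₀ (r / 2), ∀ τ ∈ Icc (0 : ℝ) 1,
        x + τ • h ∈ Metric.ball x₀ r := by
      intro x hx τ hτ
      rw [mem_ball_iff_norm] at hx ⊢
      calc ‖x + τ • h - x₀‖ = ‖(x - x₀) + τ • h‖ := by congr 1; abel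
        _ ≤ ‖x - x₀‖ + ‖τ • h‖ := norm_add_le _ _
        _ ≤ ‖x - x₀‖ + ‖h‖ := by
            rw [norm_smul, Real.norm_of_nonneg hτ.1]
            gcongr
            exact mul_le_of_le_one_left (norm_nonneg _) hτ.2
        _ < r := by linarith
    have heq : ∀ᵐ x ∂μ, x ∈ Metric.ball x₀ (r / 2) → f (x + h) = f x := by
      filter_upwards [hae] with x hx hxb
      have hlip : LipschitzOnWith (K * ‖h‖₊) (fun τ : ℝ => f (x + τ • h)) (uIcc 0 1) := by
        rw [uIcc_of_le zero_le_one]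
        have hl : LipschitzWith ‖h‖₊ fun τ : ℝ => x + τ • h :=
          LipschitzWith.of_dist_le_mul fun a b => by
            rw [dist_add_left, dist_eq_norm, ← sub_smul, norm_smul, mul_comm, dist_eq_norm]
            rfl
        exact hf.comp hl.lipschitzOnWith fun τ hτ => hrt (hseg x hxb τ hτ)
      obtain ⟨C, hC⟩ := hlip.absolutelyContinuousOnInterval.const_of_ae_hasDerivAt_zero (by
        filter_upwards [hx] with τ hτ hτI
        rw [uIcc_of_le zero_le_one] at hτI
        have h1 := hZ _ hτ (hrt (hseg x hxb τ hτI))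
        have h2 : HasDerivAt (fun τ : ℝ => x + τ • h) h τ := by
          simpa using ((hasDerivAt_id τ).smul_const h).const_add x
        have h3 := h1.comp_hasDerivAt τ h2
        rwa [zero_apply] at h3)
      have h0 := hC 0 left_mem_uIcc
      have h1 := hC 1 right_mem_uIcc
      simp only [zero_smul, add_zero, one_smul] at h0 h1
      rw [h0, h1]
    by_contra hne
    have hx₀ : x₀ ∈ Metric.ball x₀ (r / 2) := Metric.mem_ball_self (half_pos hr)
    have hc1 : ContinuousAt (fun x => f (x + h)) x₀ := by
      have := hcont (x₀ + h) (by simpa using hseg x₀ hx₀ 1 (by simp))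
      exact ContinuousAt.comp (f := fun x => x + h) this (by fun_prop)
    have hev : ∀ᶠ x in 𝓝 x₀, f (x + h) ≠ f x :=
      (hc1.prodMk (hcont x₀ (Metric.mem_ball_self hr))).eventually
        (isOpen_ne_fun continuous_fst continuous_snd |>.mem_nhds hne)
    have hpos := Measure.measure_pos_of_mem_nhds μ
      (hev.and (Metric.isOpen_ball.mem_nhds hx₀))
    refine hpos.ne' (measure_mono_null ?_ (ae_iff.1 heq))
    exact fun x hx hx' => hx.1 (hx' hx.2)
  filter_upwards [Metric.ball_mem_nhds x₀ (half_pos hr)] with y hy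
  have := key (y - x₀) (by rwa [mem_ball_iff_norm] at hy)
  rwa [add_sub_cancel] at this

end Lipschitz

/-! ### Product charts -/

theorem pi_absolutelyContinuous {p : ℕ} {α : Fin p → Type*} [∀ i, MeasurableSpace (α i)]
    {μ ν : ∀ i, Measure (α i)} [∀ i, SigmaFinite (μ i)] [∀ i, SigmaFinite (ν i)]
    (h : ∀ i, μ i ≪ ν i) : Measure.pi μ ≪ Measure.pi ν := by
  induction p with
  | zero =>
    have : Measure.pi μ = Measure.pi ν := by rw [Measure.pi_of_empty, Measure.pi_of_empty]
    rw [this]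
  | succ p ih =>
    have hμ := (measurePreserving_piFinSuccAbove μ 0).symm
    have hν := (measurePreserving_piFinSuccAbove ν 0).symm
    rw [← hμ.map_eq, ← hν.map_eq]
    exact ((h 0).prod (ih fun i => h _)).map (MeasurableEquiv.measurable _)

section ProductChart

variable {p : ℕ} {m : Fin p → ℕ} {N : Fin p → Type*}
  [∀ q, TopologicalSpace (N q)] [∀ q, ChartedSpace (EuclideanSpace ℝ (Fin (m q))) (N q)]

/-- The preferred chart of `∏ N_q` around `θ`, with values in `∏ ℝ^{m_q}`. -/
noncomputable abbrev prodChart (m : Fin p → ℕ)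
    [∀ q, ChartedSpace (EuclideanSpace ℝ (Fin (m q))) (N q)] (θ : ∀ q, N q) :
    PartialEquiv (∀ q, N q) (∀ q, EuclideanSpace ℝ (Fin (m q))) :=
  extChartAt (ModelWithCorners.pi fun q => 𝓡 (m q)) θ

theorem prodChart_apply (θ η : ∀ q, N q) (q : Fin p) :
    prodChart m θ η q = extChartAt (𝓡 (m q)) (θ q) (η q) := rfl

theorem prodChart_source (θ : ∀ q, N q) :
    (prodChart m θ).source = univ.pi fun q => (extChartAt (𝓡 (m q)) (θ q)).source := by
  ext η
  simp [prodChart, piChartedSpace_chartAt]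

theorem prodChart_target (θ : ∀ q, N q) :
    (prodChart m θ).target = univ.pi fun q => (extChartAt (𝓡 (m q)) (θ q)).target := by
  ext y
  constructor
  · intro hy q _
    have := (prodChart m θ).map_target hy
    rw [prodChart_source] at this
    have h2 := (extChartAt (𝓡 (m q)) (θ q)).map_source (this q trivial)
    have h3 := congrFun ((prodChart m θ).right_inv hy) q
    rw [prodChart_apply] at h3
    rwa [h3] at h2
  · intro hy
    have h1 : (prodChart m θ).symm y ∈ (prodChart m θ).source := by
      rw [prodChart_source]
      exact fun q _ => (extChartAt (𝓡 (m q)) (θ q)).map_target (hy q trivial)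
    have h2 := (prodChart m θ).map_source h1
    have h3 : prodChart m θ ((prodChart m θ).symm y) = y :=
      funext fun q => (extChartAt (𝓡 (m q)) (θ q)).right_inv (hy q trivial)
    rwa [h3] at h2

theorem isOpen_prodChart_target (θ : ∀ q, N q) : IsOpen (prodChart m θ).target := by
  rw [prodChart_target]
  exact isOpen_set_pi finite_univ fun q _ => isOpen_extChartAt_target _

theorem continuous_of_isLipschitz {ρ : (∀ q, N q) → ℝ} (hρ : IsLipschitz m ρ) :
    Continuous ρ := by
  refine continuous_iff_continuousAt.2 fun θ => ?_
  obtain ⟨K, t, ht, hL⟩ := hρ θ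
  have h1 : ContinuousAt (ρ ∘ (prodChart m θ).symm) (prodChart m θ θ) :=
    hL.continuousOn.continuousAt ht
  have h2 : ContinuousAt (prodChart m θ) θ := continuousAt_extChartAt θ
  refine (h1.comp (f := prodChart m θ) h2).congr ?_
  filter_upwards [extChartAt_source_mem_nhds (I := ModelWithCorners.pi fun q => 𝓡 (m q)) θ]
    with η hη
  exact congrArg ρ ((prodChart m θ).left_inv hη)

variable [∀ q, IsManifold (𝓡 (m q)) ∞ (N q)] [∀ q, CompactSpace (N q)]
  [∀ q, MeasurableSpace (N q)] [∀ q, BorelSpace (N q)] [∀ q, SecondCountableTopology (N q)]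

/-- A property that holds almost everywhere on `∏ N_q` holds almost everywhere in each product
chart, because the chart images of null sets are Lebesgue null. -/
theorem ae_prodChart (g : ∀ q, RiemMetric (m q) (N q)) (θ : ∀ q, N q) {P : (∀ q, N q) → Prop}
    (h : ∀ᵐ η ∂baseVolume g, P η) :
    ∀ᵐ y, y ∈ (prodChart m θ).target → P ((prodChart m θ).symm y) := by
  obtain ⟨Z, hPZ, hZ, hZ0⟩ := exists_measurable_superset_of_null (ae_iff.1 h)
  have hT := (isOpen_prodChart_target (m := m) θ).measurableSet
  have hm := (continuousOn_extChartAt_symm (I := ModelWithCorners.pi fun q => 𝓡 (m q))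
    θ).measurableSet_inter_preimage hT hZ
  have hae : ∀ q, AEMeasurable (extChartAt (𝓡 (m q)) (θ q))
      ((riemannianVolume (g q)).restrict (extChartAt (𝓡 (m q)) (θ q)).source) := fun q =>
    (continuousOn_extChartAt (θ q)).aemeasurable (isOpen_extChartAt_source (θ q)).measurableSet
  have hac := pi_absolutelyContinuous fun q => restrict_target_absolutelyContinuous (g q) (θ q)
  rw [← Measure.pi_map_pi hae, ← Measure.restrict_pi_pi, ← Measure.restrict_pi_pi,
    ← prodChart_target (m := m), ← prodChart_source (m := m)] at hac
  have hm0 : (Measure.pi fun q => (volume : Measure (EuclideanSpace ℝ (Fin (m q))))).restrict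
      (prodChart m θ).target ((prodChart m θ).target ∩ (prodChart m θ).symm ⁻¹' Z) = 0 := by
    refine hac ?_
    have hS : MeasurableSet (prodChart m θ).source :=
      (isOpen_extChartAt_source (I := ModelWithCorners.pi fun q => 𝓡 (m q)) θ).measurableSet
    have hc : ContinuousOn (prodChart m θ) (prodChart m θ).source := continuousOn_extChartAt θ
    erw [Measure.map_apply_of_aemeasurable (hc.aemeasurable hS) hm]
    rw [Measure.restrict_apply' hS]
    refine measure_mono_null ?_ hZ0
    rintro η ⟨⟨-, hη⟩, hηS⟩
    have : (prodChart m θ).symm (prodChart m θ η) ∈ Z := hη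
    rwa [(prodChart m θ).left_inv hηS] at this
  rw [Measure.restrict_apply hm, inter_eq_left.2 inter_subset_left] at hm0
  filter_upwards [measure_eq_zero_iff_ae_notMem.1 hm0] with y hy hyT
  by_contra hP
  exact hy ⟨hyT, hPZ hP⟩

end ProductChart

/-! ### The area density of a radial graph in product charts -/

section

variable {n : ℕ} {X : Type*} [TopologicalSpace X]
  [ChartedSpace (EuclideanSpace ℝ (Fin n)) X] [IsManifold (𝓡 n) ∞ X]

theorem chartDeriv_self (x : X) :
    chartDeriv n x (extChartAt (𝓡 n) x x) = ContinuousLinearMap.id ℝ _ := by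
  have h := mfderivWithin_range_extChartAt_symm (I := 𝓡 n) (x := x)
  rw [ModelWithCorners.range_eq_univ, mfderivWithin_univ] at h
  exact h

end

section Density

variable {p : ℕ} {m : Fin p → ℕ} {N : Fin p → Type*}
  [∀ q, TopologicalSpace (N q)] [∀ q, ChartedSpace (EuclideanSpace ℝ (Fin (m q))) (N q)]

/-- The differential of the inverse of the product chart around `θ`. -/
noncomputable def prodDeriv (m : Fin p → ℕ)
    [∀ q, ChartedSpace (EuclideanSpace ℝ (Fin (m q))) (N q)] (θ : ∀ q, N q)
    (y : ∀ q, EuclideanSpace ℝ (Fin (m q))) :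
    (∀ q, EuclideanSpace ℝ (Fin (m q))) →L[ℝ] (∀ q, EuclideanSpace ℝ (Fin (m q))) :=
  ContinuousLinearMap.pi fun q => (chartDeriv (m q) (θ q) (y q)).comp
    (ContinuousLinearMap.proj q)

/-- The coordinate change between two product charts. -/
noncomputable def prodTransition (m : Fin p → ℕ)
    [∀ q, ChartedSpace (EuclideanSpace ℝ (Fin (m q))) (N q)] (θ θ' : ∀ q, N q)
    (y : ∀ q, EuclideanSpace ℝ (Fin (m q))) (q : Fin p) : EuclideanSpace ℝ (Fin (m q)) :=
  transition (m q) (θ q) (θ' q) (y q)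

theorem eventuallyEq_comp_prodTransition (ρ : (∀ q, N q) → ℝ) {θ θ' : ∀ q, N q}
    {y : ∀ q, EuclideanSpace ℝ (Fin (m q))} (hy : y ∈ (prodChart m θ).target)
    (hy' : (prodChart m θ).symm y ∈ (prodChart m θ').source) :
    ρ ∘ (prodChart m θ).symm =ᶠ[𝓝 y]
      (ρ ∘ (prodChart m θ').symm) ∘ prodTransition m θ θ' := by
  rw [prodChart_target] at hy
  rw [prodChart_source] at hy'
  have hopen := isOpen_set_pi finite_univ fun q (_ : q ∈ univ) =>
    isOpen_transition_source (n := m q) (θ q) (θ' q)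
  filter_upwards [hopen.mem_nhds fun q _ => ⟨hy q trivial, hy' q trivial⟩] with z hz
  refine congrArg ρ (funext fun q => ?_)
  exact ((extChartAt (𝓡 (m q)) (θ' q)).left_inv (hz q trivial).2).symm

theorem radialDiff_eq_fderiv {ρ : (∀ q, N q) → ℝ} (hρ : Continuous ρ) (θ : ∀ q, N q)
    (v : BaseTangent m θ) :
    radialDiff ρ θ v = fderiv ℝ (ρ ∘ (prodChart m θ).symm) (prodChart m θ θ) v := by
  have hr : range (ModelWithCorners.pi fun q => 𝓡 (m q)) = univ := by
    rw [range_eq_univ]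
    exact fun y => ⟨y, rfl⟩
  by_cases h : MDifferentiableAt (ModelWithCorners.pi fun q => 𝓡 (m q)) 𝓘(ℝ, ℝ) ρ θ
  · rw [radialDiff, h.mfderiv, hr, fderivWithin_univ]
    rfl
  · have h2 : ¬ DifferentiableAt ℝ (ρ ∘ (prodChart m θ).symm) (prodChart m θ θ) := by
      refine fun hd => h ?_
      rw [mdifferentiableAt_iff, hr, differentiableWithinAt_univ]
      exact ⟨hρ.continuousAt, hd⟩
    rw [radialDiff, mfderiv_zero_of_not_mdifferentiableAt h, fderiv_zero_of_not_differentiableAt h2]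
    rfl

variable [∀ q, IsManifold (𝓡 (m q)) ∞ (N q)]

theorem det_prodDeriv_ne_zero {θ : ∀ q, N q} {y : ∀ q, EuclideanSpace ℝ (Fin (m q))}
    (hy : y ∈ (prodChart m θ).target) :
    LinearMap.det (prodDeriv m θ y : (∀ q, EuclideanSpace ℝ (Fin (m q))) →ₗ[ℝ]
      (∀ q, EuclideanSpace ℝ (Fin (m q)))) ≠ 0 := by
  rw [prodChart_target] at hy
  have hinj : Function.Injective (prodDeriv m θ y : (∀ q, EuclideanSpace ℝ (Fin (m q))) →ₗ[ℝ]
      (∀ q, EuclideanSpace ℝ (Fin (m q)))) := by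
    intro v w h
    funext q
    have h1 := LinearMap.equivOfDetNeZero (chartDeriv (m q) (θ q) (y q) :
      EuclideanSpace ℝ (Fin (m q)) →ₗ[ℝ] EuclideanSpace ℝ (Fin (m q)))
      (det_chartDeriv_ne_zero (hy q trivial)) |>.injective
    exact h1 (congrFun h q)
  have := (LinearEquiv.ofInjectiveEndo _ hinj).isUnit_det'
  exact this.ne_zero

theorem hasFDerivAt_prodTransition {θ θ' : ∀ q, N q}
    {y : ∀ q, EuclideanSpace ℝ (Fin (m q))} (hy : y ∈ (prodChart m θ).target)
    (hy' : (prodChart m θ).symm y ∈ (prodChart m θ').source) :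
    HasFDerivAt (prodTransition m θ θ') (ContinuousLinearMap.pi fun q =>
      (fderiv ℝ (transition (m q) (θ q) (θ' q)) (y q)).comp (ContinuousLinearMap.proj q)) y := by
  rw [prodChart_target] at hy
  rw [prodChart_source] at hy'
  refine hasFDerivAt_pi.2 fun q => ?_
  exact (differentiableAt_transition (hy q trivial) (hy' q trivial)).hasFDerivAt.comp y
    (ContinuousLinearMap.proj (R := ℝ) (φ := fun q => EuclideanSpace ℝ (Fin (m q))) q).hasFDerivAt

/-- The differential of `ρ` in a chart around another point. -/
theorem fderiv_comp_prodChart_symm {ρ : (∀ q, N q) → ℝ} (hρ : Continuous ρ) {θ₀ θ : ∀ q, N q}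
    (hθ : θ ∈ (prodChart m θ₀).source) (v : ∀ q, EuclideanSpace ℝ (Fin (m q))) :
    fderiv ℝ (ρ ∘ (prodChart m θ₀).symm) (prodChart m θ₀ θ) v =
      radialDiff (m := m) ρ θ (prodDeriv m θ₀ (prodChart m θ₀ θ) v) := by
  set y := prodChart m θ₀ θ with hydef
  have hy : y ∈ (prodChart m θ₀).target := (prodChart m θ₀).map_source hθ
  have hsy : (prodChart m θ₀).symm y = θ := (prodChart m θ₀).left_inv hθ
  have hθθ : θ ∈ (prodChart m θ).source := mem_extChartAt_source θ
  have hy' : (prodChart m θ₀).symm y ∈ (prodChart m θ).source := by rwa [hsy]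
  set z := prodChart m θ θ with hzdef
  have hz : z ∈ (prodChart m θ).target := mem_extChartAt_target θ
  have hsz : (prodChart m θ).symm z = θ := (prodChart m θ).left_inv hθθ
  have hz' : (prodChart m θ).symm z ∈ (prodChart m θ₀).source := by rwa [hsz]
  have hTy : prodTransition m θ₀ θ y = z := congrArg (prodChart m θ) hsy
  have hTz : prodTransition m θ θ₀ z = y := congrArg (prodChart m θ₀) hsz
  have hT := hasFDerivAt_prodTransition hy hy'
  have hderiv : (ContinuousLinearMap.pi fun q =>
      (fderiv ℝ (transition (m q) (θ₀ q) (θ q)) (y q)).comp (ContinuousLinearMap.proj q)) =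
      prodDeriv m θ₀ y := by
    refine ContinuousLinearMap.ext fun v => funext fun q => ?_
    have h1 := hy
    have h2 := hy'
    rw [prodChart_target] at h1
    rw [prodChart_source] at h2
    have h3 := chartDeriv_eq_comp (h1 q trivial) (h2 q trivial)
    have h4 : transition (m q) (θ₀ q) (θ q) (y q) = extChartAt (𝓡 (m q)) (θ q) (θ q) :=
      congrFun hTy q
    rw [h4, chartDeriv_self, ContinuousLinearMap.id_comp] at h3
    exact (congrArg (fun L => L (v q)) h3).symm
  refine Eq.trans ?_ (radialDiff_eq_fderiv hρ θ _).symm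
  rw [← hderiv]
  have hF := eventuallyEq_comp_prodTransition ρ hy hy'
  by_cases hd : DifferentiableAt ℝ (ρ ∘ (prodChart m θ).symm) z
  · rw [hF.fderiv_eq]
    rw [← hTy] at hd
    have h5 := (hd.hasFDerivAt.comp y hT).fderiv
    rw [h5, hTy]
    rfl
  · have hd' : ¬ DifferentiableAt ℝ (ρ ∘ (prodChart m θ₀).symm) y := by
      refine fun hdy => hd ?_
      rw [← hTz] at hdy
      exact (hdy.comp z (hasFDerivAt_prodTransition hz hz').differentiableAt).congr_of_eventuallyEq
        (eventuallyEq_comp_prodTransition ρ hz hz')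
    rw [fderiv_zero_of_not_differentiableAt hd, fderiv_zero_of_not_differentiableAt hd']
    rfl

/-- The differential of `ρ` as a linear form on the model space. -/
noncomputable def radialForm (m : Fin p → ℕ)
    [∀ q, ChartedSpace (EuclideanSpace ℝ (Fin (m q))) (N q)] (ρ : (∀ q, N q) → ℝ)
    (θ : ∀ q, N q) : (∀ q, EuclideanSpace ℝ (Fin (m q))) →ₗ[ℝ] ℝ :=
  let L : (∀ q, EuclideanSpace ℝ (Fin (m q))) →L[ℝ] ℝ :=
    mfderiv (ModelWithCorners.pi fun q => 𝓡 (m q)) 𝓘(ℝ, ℝ) ρ θ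
  L

theorem inducedMetric_eq (g : ∀ q, RiemMetric (m q) (N q)) (s : Fin p → ℝ → ℝ)
    (ρ : (∀ q, N q) → ℝ) (θ : ∀ q, N q) :
    inducedMetric g s ρ θ = fun v w =>
      warpForm (metricForms g θ) (fun q => s q (ρ θ)) (radialForm m ρ θ) v w := rfl

theorem relDensity_inducedMetric_eq (g : ∀ q, RiemMetric (m q) (N q)) (s : Fin p → ℝ → ℝ)
    (ρ : (∀ q, N q) → ℝ) (θ : ∀ q, N q) :
    relDensity (baseFrame (m := m) θ) (baseMetric g θ) (inducedMetric g s ρ θ) =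
      relDensity (productFrame m) (fun v w => warpForm (metricForms g θ) 1 0 v w)
        (fun v w => warpForm (metricForms g θ) (fun q => s q (ρ θ)) (radialForm m ρ θ) v w) := by
  rw [baseFrame_eq, baseMetric_eq, inducedMetric_eq]
  rfl

/-- A radial graph has at least the area density of the slice through the same point, since its
metric exceeds that of the slice by the square `dρ ⊗ dρ`. -/
theorem areaFactor_le_relDensity (g : ∀ q, RiemMetric (m q) (N q)) (s : Fin p → ℝ → ℝ)
    (ρ : (∀ q, N q) → ℝ) (θ : ∀ q, N q) :
    areaFactor m s (ρ θ) ≤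
      relDensity (baseFrame (m := m) θ) (baseMetric g θ) (inducedMetric g s ρ θ) := by
  rw [relDensity_inducedMetric_eq]
  exact prod_le_relDensity_warpForm (metricForms_symm g θ) (metricForms_pos g θ) _ _

theorem radialDiff_eq_zero_of_relDensity_eq (g : ∀ q, RiemMetric (m q) (N q)) (s : Fin p → ℝ → ℝ)
    (ρ : (∀ q, N q) → ℝ) (θ : ∀ q, N q) (hA : 0 < areaFactor m s (ρ θ))
    (h : relDensity (baseFrame (m := m) θ) (baseMetric g θ) (inducedMetric g s ρ θ) =
      areaFactor m s (ρ θ)) (v : BaseTangent m θ) : radialDiff ρ θ v = 0 := by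
  rw [relDensity_inducedMetric_eq] at h
  have h1 := eq_zero_of_relDensity_warpForm (metricForms_symm g θ) (metricForms_pos g θ) hA h
  exact congrArg (fun L : (∀ q, EuclideanSpace ℝ (Fin (m q))) →ₗ[ℝ] ℝ => L v) h1

theorem relDensity_inducedMetric_const (g : ∀ q, RiemMetric (m q) (N q)) {s : Fin p → ℝ → ℝ}
    {R : ℝ} (hs : ∀ q, 0 ≤ s q R) (θ : ∀ q, N q) :
    relDensity (baseFrame (m := m) θ) (baseMetric g θ) (inducedMetric g s (fun _ => R) θ) =
      areaFactor m s R := by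
  have h0 : radialForm m (fun _ : ∀ q, N q => R) θ = 0 := by
    simp only [radialForm]
    rw [mfderiv_const]
    rfl
  rw [relDensity_inducedMetric_eq, h0]
  exact relDensity_warpForm_zero (metricForms_symm g θ) (metricForms_pos g θ) hs

variable [∀ q, MeasurableSpace (N q)] [∀ q, BorelSpace (N q)]
  [∀ q, SecondCountableTopology (N q)]

/-- The area density is measurable: within a product chart, it is the quotient of the determinants
of two Gram matrices with measurable entries. -/
theorem aemeasurable_relDensity (g : ∀ q, RiemMetric (m q) (N q)) {s : Fin p → ℝ → ℝ}
    {ρ : (∀ q, N q) → ℝ} (hρ : Continuous ρ) (hs : ∀ q, Continuous fun θ => s q (ρ θ))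
    (μ : Measure (∀ q, N q)) :
    AEMeasurable (fun θ => relDensity (baseFrame (m := m) θ) (baseMetric g θ)
      (inducedMetric g s ρ θ)) μ := by
  obtain ⟨S, hS, hcover⟩ := TopologicalSpace.countable_cover_nhds
    (fun θ : ∀ q, N q => extChartAt_source_mem_nhds (I := ModelWithCorners.pi fun q => 𝓡 (m q)) θ)
  have := hS.to_subtype
  rw [← Measure.restrict_univ (μ := μ), ← hcover, biUnion_eq_iUnion, aemeasurable_iUnion_iff]
  rintro ⟨θ₀, -⟩
  change AEMeasurable _ (μ.restrict (prodChart m θ₀).source)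
  have hsrc : MeasurableSet (prodChart m θ₀).source :=
    (isOpen_extChartAt_source (I := ModelWithCorners.pi fun q => 𝓡 (m q)) θ₀).measurableSet
  have hcc : ContinuousOn (prodChart m θ₀) (prodChart m θ₀).source := continuousOn_extChartAt θ₀
  have hc := hcc.aemeasurable hsrc (μ := μ)
  let b := productFrame m
  let D : (∀ q, N q) → (∀ q, EuclideanSpace ℝ (Fin (m q))) →ₗ[ℝ]
      (∀ q, EuclideanSpace ℝ (Fin (m q))) := fun θ => prodDeriv m θ₀ (prodChart m θ₀ θ)
  have hform : ∀ q i j, AEMeasurable (fun θ => metricForms g θ q (D θ (b i) q) (D θ (b j) q))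
      (μ.restrict (prodChart m θ₀).source) := by
    intro q i j
    refine ContinuousOn.aemeasurable ?_ hsrc
    have h1 := continuousOn_metricForm_chartDeriv (g q) (θ₀ q) (b i q) (b j q)
    have h2 : ContinuousOn (fun θ : ∀ q, N q => extChartAt (𝓡 (m q)) (θ₀ q) (θ q))
        (prodChart m θ₀).source := (continuous_apply q).comp_continuousOn hcc
    refine (h1.comp h2 fun θ hθ => ?_).congr fun θ hθ => ?_
    · rw [prodChart_source] at hθ
      exact (extChartAt (𝓡 (m q)) (θ₀ q)).map_source (hθ q trivial)
    · rw [prodChart_source] at hθ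
      simp only [Function.comp_apply, (extChartAt (𝓡 (m q)) (θ₀ q)).left_inv (hθ q trivial)]
      rfl
  have hdiff : ∀ i, AEMeasurable (fun θ => fderiv ℝ (ρ ∘ (prodChart m θ₀).symm)
      (prodChart m θ₀ θ) (b i)) (μ.restrict (prodChart m θ₀).source) := fun i =>
    (measurable_fderiv_apply_const ℝ (ρ ∘ (prodChart m θ₀).symm) (b i)).comp_aemeasurable hc
  have hdet : ∀ M : (∀ q, N q) → Matrix (Σ q, Fin (m q)) (Σ q, Fin (m q)) ℝ,
      (∀ i j, AEMeasurable (fun θ => M θ i j) (μ.restrict (prodChart m θ₀).source)) →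
      AEMeasurable (fun θ => (M θ).det) (μ.restrict (prodChart m θ₀).source) := by
    intro M hM
    simp only [Matrix.det_apply']
    exact Finset.aemeasurable_fun_sum _ fun τ _ => aemeasurable_const.mul
      (Finset.aemeasurable_fun_prod _ fun i _ => hM _ _)
  have hmeas : AEMeasurable (fun θ => Real.sqrt
      ((Matrix.of fun i j => fderiv ℝ (ρ ∘ (prodChart m θ₀).symm) (prodChart m θ₀ θ) (b i) *
          fderiv ℝ (ρ ∘ (prodChart m θ₀).symm) (prodChart m θ₀ θ) (b j) +
          ∑ q, s q (ρ θ) ^ 2 * metricForms g θ q (D θ (b i) q) (D θ (b j) q)).det /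
        (Matrix.of fun i j => ∑ q, metricForms g θ q (D θ (b i) q) (D θ (b j) q)).det))
      (μ.restrict (prodChart m θ₀).source) := by
    refine Real.continuous_sqrt.measurable.comp_aemeasurable ((hdet _ fun i j => ?_).div
      (hdet _ fun i j => ?_))
    · exact ((hdiff i).mul (hdiff j)).add (Finset.aemeasurable_fun_sum _ fun q _ =>
        ((hs q).measurable.pow_const 2).aemeasurable.mul (hform q i j))
    · exact Finset.aemeasurable_fun_sum Finset.univ fun q _ => hform q i j
  refine hmeas.congr ?_
  filter_upwards [ae_restrict_mem hsrc] with θ hθ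
  rw [relDensity_inducedMetric_eq, ← relDensity_comp (productFrame m) _ _ (D θ)
    (det_prodDeriv_ne_zero ((prodChart m θ₀).map_source hθ))]
  simp only [relDensity, warpForm_one_zero_apply]
  simp only [warpForm_apply, fderiv_comp_prodChart_symm hρ hθ]
  rfl

end Density

/-! ### The isoperimetric inequality -/

section Isoperimetric

theorem radialGraph_injective {p : ℕ} {N : Fin p → Type*} {lam : EReal}
    {ρ ρ' : (∀ q, N q) → radii lam} (h : radialGraph ρ = radialGraph ρ') : ρ = ρ' := by
  funext θ
  have : (ρ θ, θ) ∈ radialGraph ρ' := h ▸ rfl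
  exact this

variable {p : ℕ} {m : Fin p → ℕ} {N : Fin p → Type*} {lam : EReal}
  [∀ q, TopologicalSpace (N q)] [∀ q, ChartedSpace (EuclideanSpace ℝ (Fin (m q))) (N q)]
  [∀ q, IsManifold (𝓡 (m q)) ∞ (N q)] [∀ q, CompactSpace (N q)]
  [∀ q, MeasurableSpace (N q)] [∀ q, BorelSpace (N q)]

theorem baseVolume_real_pos [∀ q, Nonempty (N q)] (g : ∀ q, RiemMetric (m q) (N q)) :
    0 < (baseVolume g).real univ :=
  ENNReal.toReal_pos (isOpen_univ.measure_ne_zero _ univ_nonempty) (measure_ne_top _ _)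

variable [∀ q, SecondCountableTopology (N q)]

/-- A Lipschitz function whose differential vanishes almost everywhere on the open set `{ρ > 0}` is
locally constant on this set. -/
theorem eventually_eq_of_ae_radialDiff_eq_zero (g : ∀ q, RiemMetric (m q) (N q))
    {ρ : (∀ q, N q) → ℝ} (hρ : IsLipschitz m ρ)
    (h : ∀ᵐ θ ∂baseVolume g, 0 < ρ θ → ∀ v : BaseTangent m θ, radialDiff ρ θ v = 0)
    {θ₀ : ∀ q, N q} (h0 : 0 < ρ θ₀) : ∀ᶠ θ in 𝓝 θ₀, ρ θ = ρ θ₀ := by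
  have hc := continuous_of_isLipschitz hρ
  obtain ⟨K, t, ht, hL⟩ := hρ θ₀
  set e := prodChart m θ₀ with he
  have hT : e.target ∈ 𝓝 (e θ₀) :=
    (isOpen_prodChart_target (m := m) θ₀).mem_nhds (mem_extChartAt_target θ₀)
  have hce : ContinuousAt e θ₀ := continuousAt_extChartAt θ₀
  have hse : ContinuousAt e.symm (e θ₀) := continuousAt_extChartAt_symm θ₀
  have hes : e.symm (e θ₀) = θ₀ := e.left_inv (mem_extChartAt_source θ₀)
  have hpos : ∀ᶠ y in 𝓝 (e θ₀), 0 < ρ (e.symm y) :=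
    (hc.continuousAt.comp hse).eventually (lt_mem_nhds (by simpa [hes] using h0))
  set U := interior (t ∩ e.target ∩ {y | 0 < ρ (e.symm y)}) with hU
  have hUn : U ∈ 𝓝 (e θ₀) :=
    interior_mem_nhds.2 (Filter.inter_mem (Filter.inter_mem ht hT) hpos)
  have hUsub : U ⊆ t ∩ e.target ∩ {y | 0 < ρ (e.symm y)} := interior_subset
  have hLU : LipschitzOnWith K (ρ ∘ e.symm) U := hL.mono fun y hy => (hUsub hy).1.1
  have hae : ∀ᵐ y, y ∈ U → HasFDerivAt (ρ ∘ e.symm)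
      (0 : (∀ q, EuclideanSpace ℝ (Fin (m q))) →L[ℝ] ℝ) y := by
    filter_upwards [hLU.ae_differentiableWithinAt_of_mem (μ := volume), ae_prodChart g θ₀ h]
      with y hy1 hy2 hyU
    have hyT : y ∈ e.target := (hUsub hyU).1.2
    have hd := (hy1 hyU).differentiableAt (isOpen_interior.mem_nhds hyU)
    have h3 := fderiv_comp_prodChart_symm hc (e.map_target hyT)
    rw [← he, e.right_inv hyT] at h3
    have h4 : fderiv ℝ (ρ ∘ e.symm) y = 0 := ContinuousLinearMap.ext fun v =>
      (h3 v).trans (hy2 hyT (hUsub hyU).2 _)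
    exact h4 ▸ hd.hasFDerivAt
  have hev := eventually_eq_of_lipschitzOnWith_of_ae_hasFDerivAt_zero volume hLU hUn hae
  filter_upwards [hce.eventually hev, extChartAt_source_mem_nhds
    (I := ModelWithCorners.pi fun q => 𝓡 (m q)) θ₀] with θ hθ hθs
  simpa only [Function.comp_apply, hes, e.left_inv hθs] using hθ

theorem ofReal_integral_le_lintegral_ofReal {α : Type*} [MeasurableSpace α] {μ : Measure α}
    {f : α → ℝ} (hf : Integrable f μ) :
    ENNReal.ofReal (∫ x, f x ∂μ) ≤ ∫⁻ x, ENNReal.ofReal (f x) ∂μ := by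
  rw [integral_eq_lintegral_pos_part_sub_lintegral_neg_part hf]
  exact (ENNReal.ofReal_le_ofReal (sub_le_self _ ENNReal.toReal_nonneg)).trans
    ENNReal.ofReal_toReal_le

/-- The weight `a = ψ / A` is continuous at positive radii, because a convex function is continuous
in the interior of its domain. -/
theorem ConvexAlong.measurable_weight {s : Fin p → ℝ → ℝ} {a w : ℝ → ℝ}
    (hs : ∀ q, ContinuousOn (s q) (radii lam))
    (hA : ∀ r ∈ radii lam, 0 < r → 0 < areaFactor m s r) (hw : StrictMonoOn w (radii lam))
    (hwc : ContinuousOn w (radii lam)) (h0 : 0 ∈ radii lam)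
    (h : ConvexAlong lam (fun r => a r * areaFactor m s r) w) :
    Measurable fun r : radii lam => a r := by
  refine measurable_of_continuousOn_compl_singleton ⟨0, h0⟩ ?_
  have h1 : ContinuousOn a {r | r ∈ radii lam ∧ 0 < r} := by
    refine ((h.continuousOn hw hwc).div ((continuousOn_areaFactor hs).mono fun r hr => hr.1)
      fun r hr => (hA r hr.1 hr.2).ne').congr fun r hr => ?_
    rw [Pi.div_apply, mul_div_cancel_right₀ _ (hA r hr.1 hr.2).ne']
  refine h1.comp continuous_subtype_val.continuousOn fun r hr => ⟨r.2, ?_⟩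
  exact lt_of_le_of_ne r.2.1 fun h => hr (Subtype.ext h.symm)

variable [∀ q, Nonempty (N q)]

/-- The isoperimetric inequality with weights: the area density of the graph of `ρ` is at least
`A(ρ)`, and the supporting line of `ψ ∘ Ṽ⁻¹` at the volume of `B_R` bounds `ψ(ρ) = a(ρ) A(ρ)` from
below by an affine function of `v(ρ)`, whose mean is determined by the volume of `Ω`. -/
theorem starShapedIsoperimetric_of_convexAlong (g : ∀ q, RiemMetric (m q) (N q))
    {s : Fin p → ℝ → ℝ} {a c : ℝ → ℝ}
    (hs : ∀ q, ContinuousOn (s q) (radii lam)) (hs0 : ∀ q, ∀ r ∈ radii lam, 0 ≤ s q r)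
    (hA : ∀ r ∈ radii lam, 0 < r → 0 < areaFactor m s r)
    (ha : ∀ r ∈ radii lam, 0 < r → 0 < a r) (hc : ∀ r ∈ radii lam, 0 < r → 0 < c r)
    (hint : ∀ r ∈ radii lam, IntervalIntegrable (fun t => c t * areaFactor m s t) volume 0 r)
    (hconv : ConvexAlong lam (fun r => a r * areaFactor m s r)
      (fun r => (baseVolume g).real univ * radialVolume m s c r)) :
    StarShapedIsoperimetric lam g s a c := by
  intro Ω ρ hΩ hΩc hLip hfr
  set μ := baseVolume g with hμ
  set v := radialVolume m s c with hv
  have hN : 0 < μ.real univ := baseVolume_real_pos g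
  have hρ' : Continuous fun θ => (ρ θ : ℝ) := continuous_of_isLipschitz hLip
  have hρ : Continuous ρ := continuous_induced_rng.2 hρ'
  have hΩeq : Ω = {x | x.1 < ρ x.2} := eq_subgraph_of_frontier_eq hρ hΩ hΩc hfr
  obtain ⟨θ₁, hθ₁⟩ : ∃ θ, 0 < (ρ θ : ℝ) := by
    obtain ⟨θ⟩ : Nonempty (∀ q, N q) := inferInstance
    have h1 : (ρ θ, θ) ∈ frontier Ω := hfr ▸ rfl
    obtain ⟨x, hx⟩ := closure_nonempty_iff.1 ⟨_, frontier_subset_closure h1⟩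
    rw [hΩeq] at hx
    exact ⟨x.2, x.1.2.1.trans_lt hx⟩
  have hz : (0 : ℝ) ∈ radii lam := mem_radii_of_le (ρ θ₁).2 le_rfl hθ₁.le
  -- the radial volume
  have hvm : StrictMonoOn v (radii lam) :=
    strictMonoOn_primitive hint fun r hr h0 => mul_pos (hc r hr h0) (hA r hr h0)
  have hvc : ContinuousOn v (radii lam) := continuousOn_primitive_radii hint
  have hv0 : v 0 = 0 := intervalIntegral.integral_same
  have hvnn : ∀ r ∈ radii lam, 0 ≤ v r := fun r hr => hv0 ▸ hvm.monotoneOn hz hr hr.1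
  have hwm : StrictMonoOn (fun r => μ.real univ * v r) (radii lam) :=
    fun x hx y hy hxy => mul_lt_mul_of_pos_left (hvm hx hy hxy) hN
  have hwc : ContinuousOn (fun r => μ.real univ * v r) (radii lam) := continuousOn_const.mul hvc
  have hvol : ∀ {σ : (∀ q, N q) → radii lam}, Continuous σ →
      weightedVolume g s c {x | x.1 < σ x.2} = ENNReal.ofReal (∫ θ, v (σ θ) ∂μ) := by
    intro σ hσ
    rw [weightedVolume_subgraph g hs hs0 hc hint hσ, ofReal_integral_eq_lintegral_ofReal]
    · exact (hvc.comp_continuous (continuous_subtype_val.comp hσ)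
        fun θ => (σ θ).2).integrable_of_hasCompactSupport (HasCompactSupport.of_compactSpace _)
    · exact Filter.Eventually.of_forall fun θ => hvnn _ (σ θ).2
  have hvρc : Continuous fun θ => v (ρ θ) := hvc.comp_continuous hρ' fun θ => (ρ θ).2
  have hvρi : Integrable (fun θ => v (ρ θ)) μ :=
    hvρc.integrable_of_hasCompactSupport (HasCompactSupport.of_compactSpace _)
  -- the radius `R` with `|N| v(R) = ∫ v(ρ)`
  obtain ⟨R, hR, hRI⟩ : ∃ R ∈ radii lam, μ.real univ * v R = ∫ θ, v (ρ θ) ∂μ := by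
    obtain ⟨α, -, hα⟩ := isCompact_univ.exists_isMinOn univ_nonempty hvρc.continuousOn
    obtain ⟨β, -, hβ⟩ := isCompact_univ.exists_isMaxOn univ_nonempty hvρc.continuousOn
    have h1 : μ.real univ * v (ρ α) ≤ ∫ θ, v (ρ θ) ∂μ := by
      rw [← smul_eq_mul, ← integral_const]
      exact integral_mono (integrable_const _) hvρi fun θ => hα (mem_univ θ)
    have h2 : ∫ θ, v (ρ θ) ∂μ ≤ μ.real univ * v (ρ β) := by
      rw [← smul_eq_mul, ← integral_const]
      exact integral_mono hvρi (integrable_const _) fun θ => hβ (mem_univ θ)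
    exact (ordConnected_radii.isPreconnected.image _ hwc).ordConnected.out
      (mem_image_of_mem _ (ρ α).2) (mem_image_of_mem _ (ρ β).2) ⟨h1, h2⟩
  have hR0 : 0 < R := by
    have h1 : 0 < ∫ θ, v (ρ θ) ∂μ :=
      hvρc.integral_pos_of_hasCompactSupport_nonneg_nonzero (HasCompactSupport.of_compactSpace _)
        (fun θ => hvnn _ (ρ θ).2) (x := θ₁) (hv0 ▸ hvm hz (ρ θ₁).2 hθ₁).ne'
    refine lt_of_le_of_ne hR.1 fun h => ?_
    rw [← hRI, ← h, hv0, mul_zero] at h1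
    exact lt_irrefl _ h1
  have hball : ∀ R' : radii lam,
      weightedVolume g s c (ball N R') = ENNReal.ofReal (μ.real univ * v R') := fun R' => by
    rw [← smul_eq_mul, ← integral_const]
    exact hvol continuous_const
  have huniq : ∀ R' : radii lam,
      weightedVolume g s c (ball N R') = weightedVolume g s c Ω ↔ R' = ⟨R, hR⟩ := by
    intro R'
    rw [hball, hΩeq, hvol hρ, ← hRI,
      ENNReal.ofReal_eq_ofReal_iff (mul_nonneg hN.le (hvnn _ R'.2)) (mul_nonneg hN.le (hvnn _ hR)),
      mul_right_inj' hN.ne', hvm.injOn.eq_iff R'.2 hR, Subtype.ext_iff]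
  have hslice : ∀ r : radii lam, 0 < (r : ℝ) → surfaceIntegral g s a (fun _ => r) =
      ENNReal.ofReal (μ.real univ * (a r * areaFactor m s r)) := by
    intro r h0
    simp only [surfaceIntegral, relDensity_inducedMetric_const g (fun q => hs0 q r r.2)]
    rw [lintegral_const, ← ENNReal.ofReal_mul (ha r r.2 h0).le, ENNReal.ofReal_mul hN.le, mul_comm,
      measureReal_def, ENNReal.ofReal_toReal (measure_ne_top _ _)]
  -- the supporting line at `R`, integrated over `N`
  obtain ⟨k, hk⟩ := hconv.exists_support hwm hwc hR hR0
  set ψ := fun r => a r * areaFactor m s r with hψ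
  set L := fun θ => ψ R + k * (μ.real univ * v (ρ θ) - μ.real univ * v R) with hL
  have hsub : Integrable (fun θ => μ.real univ * v (ρ θ) - μ.real univ * v R) μ :=
    (hvρi.const_mul _).sub (integrable_const _)
  have hLi : Integrable L μ := (integrable_const _).add (hsub.const_mul k)
  have hLint : ∫ θ, L θ ∂μ = μ.real univ * ψ R := by
    have h1 : ∫ θ, L θ ∂μ =
        ∫ _, ψ R ∂μ + ∫ θ, k * (μ.real univ * v (ρ θ) - μ.real univ * v R) ∂μ :=
      integral_add (integrable_const _) (hsub.const_mul k)
    have h2 : ∫ θ, (μ.real univ * v (ρ θ) - μ.real univ * v R) ∂μ =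
        ∫ θ, μ.real univ * v (ρ θ) ∂μ - ∫ _, μ.real univ * v R ∂μ :=
      integral_sub (hvρi.const_mul _) (integrable_const _)
    rw [h1, integral_const_mul k, h2, integral_const_mul (μ.real univ), integral_const,
      integral_const, smul_eq_mul, smul_eq_mul, ← hRI]
    ring
  set δ := fun θ => relDensity (baseFrame (m := m) θ) (baseMetric g θ)
    (inducedMetric g s (fun η => (ρ η : ℝ)) θ) with hδ
  have hAδ : ∀ θ, areaFactor m s (ρ θ) ≤ δ θ := fun θ =>
    areaFactor_le_relDensity g s (fun η => (ρ η : ℝ)) θ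
  have hpt : ∀ θ, ENNReal.ofReal (ψ (ρ θ)) ≤ ENNReal.ofReal (a (ρ θ)) * ENNReal.ofReal (δ θ) := by
    intro θ
    rcases le_or_gt 0 (a (ρ θ)) with h | h
    · rw [← ENNReal.ofReal_mul h]
      exact ENNReal.ofReal_le_ofReal (mul_le_mul_of_nonneg_left (hAδ θ) h)
    · rw [ENNReal.ofReal_of_nonpos]
      · exact zero_le
      · exact mul_nonpos_of_nonpos_of_nonneg h.le (areaFactor_nonneg hs0 (ρ θ).2)
  have hLF : ∀ θ, ENNReal.ofReal (L θ) ≤ ENNReal.ofReal (a (ρ θ)) * ENNReal.ofReal (δ θ) :=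
    fun θ => (ENNReal.ofReal_le_ofReal (hk _ (ρ θ).2)).trans (hpt θ)
  have hJ : surfaceIntegral g s a (fun _ => (⟨R, hR⟩ : radii lam)) ≤
      ∫⁻ θ, ENNReal.ofReal (L θ) ∂μ := by
    rw [hslice _ hR0]
    exact hLint ▸ ofReal_integral_le_lintegral_ofReal hLi
  refine ⟨⟨R, hR⟩, huniq, frontier_ball _ hR0, hJ.trans (lintegral_mono hLF), fun hconn => ⟨?_, ?_⟩⟩
  · intro heq
    -- in the case of equality, the two bounds for the integrand are attained almost everywhere
    have hFm : AEMeasurable (fun θ => ENNReal.ofReal (a (ρ θ)) * ENNReal.ofReal (δ θ)) μ := by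
      refine AEMeasurable.fun_mul ?_ ?_
      · exact (ENNReal.measurable_ofReal.comp
          ((hconv.measurable_weight hs hA hwm hwc hz).comp hρ.measurable)).aemeasurable
      · exact (aemeasurable_relDensity g hρ' (fun q => (hs q).comp_continuous hρ'
          fun θ => (ρ θ).2) μ).ennreal_ofReal
    have hae := ae_eq_of_ae_le_of_lintegral_le (Filter.Eventually.of_forall hLF)
      hLi.lintegral_lt_top.ne hFm (heq.le.trans hJ)
    have hzero : ∀ᵐ θ ∂μ, 0 < (ρ θ : ℝ) →
        ∀ w : BaseTangent m θ, radialDiff (fun η => (ρ η : ℝ)) θ w = 0 := by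
      filter_upwards [hae] with θ hθ h0
      have hA0 := hA _ (ρ θ).2 h0
      have ha0 := ha _ (ρ θ).2 h0
      have h1 : a (ρ θ) * δ θ = a (ρ θ) * areaFactor m s (ρ θ) := by
        have h2 : ENNReal.ofReal (a (ρ θ)) * ENNReal.ofReal (δ θ) = ENNReal.ofReal (ψ (ρ θ)) :=
          le_antisymm (hθ ▸ ENNReal.ofReal_le_ofReal (hk _ (ρ θ).2)) (hpt θ)
        rwa [← ENNReal.ofReal_mul ha0.le, ENNReal.ofReal_eq_ofReal_iff
          (mul_nonneg ha0.le (hA0.le.trans (hAδ θ))) (mul_nonneg ha0.le hA0.le)] at h2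
      exact radialDiff_eq_zero_of_relDensity_eq g s _ θ hA0 (mul_left_cancel₀ ha0.ne' h1)
    have hclopen : IsClopen {θ | (ρ θ : ℝ) = ρ θ₁} := by
      refine ⟨isClosed_eq hρ' continuous_const, isOpen_iff_mem_nhds.2 fun θ hθ => ?_⟩
      have hθ0 : 0 < (ρ θ : ℝ) := by rw [show (ρ θ : ℝ) = ρ θ₁ from hθ]; exact hθ₁
      filter_upwards [eventually_eq_of_ae_radialDiff_eq_zero g hLip hzero hθ0] with η hη
      exact hη.trans hθ
    have huniv := hclopen.eq_univ ⟨θ₁, rfl⟩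
    refine ⟨ρ θ₁, hfr.trans (congrArg radialGraph (funext fun θ => Subtype.ext ?_))⟩
    exact huniv.ge (mem_univ θ)
  · rintro ⟨r₀, hr₀⟩
    have hρr : ρ = fun _ => r₀ := radialGraph_injective (hfr.symm.trans hr₀)
    have h1 : r₀ = ⟨R, hR⟩ := by
      refine (huniq r₀).1 ?_
      rw [hΩeq, hρr]
      rfl
    rw [hρr, h1]

end Isoperimetric

/-! ### The weights `(1, 1)` and a single warping function -/

section Unweighted

variable {p : ℕ} {m : Fin p → ℕ} {N : Fin p → Type*} {lam : EReal}

theorem areaFactor_eq_pow {s : Fin p → ℝ → ℝ} {σ : ℝ → ℝ} (h : ∀ q, s q = σ) :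
    areaFactor m s = fun r => σ r ^ ∑ q, m q := by
  funext r
  simp only [areaFactor, h, Finset.prod_pow_eq_pow_sum]

theorem convexAlong_const {w : ℝ → ℝ} (hw : StrictMonoOn w (radii lam))
    (hc : ContinuousOn w (radii lam)) (k : ℝ) : ConvexAlong lam (fun _ => k) w := by
  rw [convexAlong_iff_slope hw hc]
  simp

theorem convexAlong_areaFactor_iff {s : Fin p → ℝ → ℝ} {σ : ℝ → ℝ}
    (hs : ∀ q, ContinuousOn (s q) (radii lam)) (hs0 : ∀ q, ∀ r ∈ radii lam, 0 ≤ s q r)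
    (hA : ∀ r ∈ radii lam, 0 < r → 0 < areaFactor m s r) (hsσ : ∀ q, s q = σ)
    (hd : ∀ r ∈ radii lam, 0 < r → DifferentiableAt ℝ σ r ∧ DifferentiableAt ℝ (deriv σ) r)
    (hm : 0 < ∑ q, m q) :
    ConvexAlong lam (areaFactor m s) (radialVolume m s fun _ => 1) ↔
      ∀ r ∈ radii lam, 0 < r → 0 ≤ σ r * deriv (deriv σ) r - deriv σ r ^ 2 := by
  obtain ⟨q, -, -⟩ := Finset.exists_ne_zero_of_sum_ne_zero hm.ne'
  have hpos : ∀ r ∈ radii lam, 0 < r → 0 < σ r := fun r hr h0 => by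
    refine lt_of_le_of_ne (hsσ q ▸ hs0 q r hr) fun h => (hA r hr h0).ne' ?_
    simp only [areaFactor_eq_pow hsσ, ← h, zero_pow hm.ne']
  have hw : (radialVolume m s fun _ => 1) = fun r => ∫ t in (0 : ℝ)..r, σ t ^ ∑ q, m q := by
    funext r
    simp only [radialVolume, one_mul, areaFactor_eq_pow hsσ]
  rw [← convexAlong_pow_iff hm (hsσ q ▸ hs q) hpos hd, hw, areaFactor_eq_pow hsσ]

variable [∀ q, TopologicalSpace (N q)] [∀ q, ChartedSpace (EuclideanSpace ℝ (Fin (m q))) (N q)]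
  [∀ q, IsManifold (𝓡 (m q)) ∞ (N q)] [∀ q, CompactSpace (N q)] [∀ q, Nonempty (N q)]
  [∀ q, MeasurableSpace (N q)] [∀ q, BorelSpace (N q)] [∀ q, SecondCountableTopology (N q)]

/-- The weights `(1, 1)`: convexity along the radial volume `v` is the same as convexity along
`|N| v`. -/
theorem starShapedIsoperimetric_one_of_convexAlong (g : ∀ q, RiemMetric (m q) (N q))
    {s : Fin p → ℝ → ℝ} (hs : ∀ q, ContinuousOn (s q) (radii lam))
    (hs0 : ∀ q, ∀ r ∈ radii lam, 0 ≤ s q r)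
    (hA : ∀ r ∈ radii lam, 0 < r → 0 < areaFactor m s r)
    (hconv : ConvexAlong lam (areaFactor m s) (radialVolume m s fun _ => 1)) :
    StarShapedIsoperimetric lam g s (fun _ => 1) (fun _ => 1) := by
  have hint : ∀ r ∈ radii lam,
      IntervalIntegrable (fun t => 1 * areaFactor m s t) volume 0 r := by
    simpa only [one_mul] using intervalIntegrable_of_continuousOn_radii (continuousOn_areaFactor hs)
  refine starShapedIsoperimetric_of_convexAlong g hs hs0 hA (fun _ _ _ => one_pos)
    (fun _ _ _ => one_pos) hint ?_
  simp only [one_mul]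
  refine hconv.const_mul (strictMonoOn_primitive hint fun r hr h0 => ?_)
    (continuousOn_primitive_radii hint) (baseVolume_real_pos g)
  rw [one_mul]
  exact hA r hr h0

theorem starShapedIsoperimetric_one_of_logConvex (g : ∀ q, RiemMetric (m q) (N q))
    {s : Fin p → ℝ → ℝ} {σ : ℝ → ℝ} (hs : ∀ q, ContinuousOn (s q) (radii lam))
    (hs0 : ∀ q, ∀ r ∈ radii lam, 0 ≤ s q r)
    (hA : ∀ r ∈ radii lam, 0 < r → 0 < areaFactor m s r) (hsσ : ∀ q, s q = σ)
    (hd : ∀ r ∈ radii lam, 0 < r → DifferentiableAt ℝ σ r ∧ DifferentiableAt ℝ (deriv σ) r)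
    (hσ : ∀ r ∈ radii lam, 0 < r → 0 ≤ σ r * deriv (deriv σ) r - deriv σ r ^ 2) :
    StarShapedIsoperimetric lam g s (fun _ => 1) (fun _ => 1) := by
  refine starShapedIsoperimetric_one_of_convexAlong g hs hs0 hA ?_
  rcases Nat.eq_zero_or_pos (∑ q, m q) with hm | hm
  · -- if `N` is zero-dimensional, then `A = 1`
    have hA1 : areaFactor m s = fun _ => 1 := by
      simp only [areaFactor_eq_pow hsσ, hm, pow_zero]
    have hint : ∀ r ∈ radii lam, IntervalIntegrable (fun _ : ℝ => (1 : ℝ) * 1) volume 0 r :=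
      intervalIntegrable_of_continuousOn_radii continuousOn_const
    have hw : (radialVolume m s fun _ => 1) = fun r => ∫ _ in (0 : ℝ)..r, (1 : ℝ) * 1 := by
      funext r
      simp only [radialVolume, hA1]
    rw [hA1, hw]
    exact convexAlong_const (strictMonoOn_primitive hint fun _ _ _ => by norm_num)
      (continuousOn_primitive_radii hint) 1
  · exact (convexAlong_areaFactor_iff hs hs0 hA hsσ hd hm).2 hσ

end Unweighted

end WarpedIso

theorem mainTheorem3 {p : ℕ} (m : Fin p → ℕ) (N : Fin p → Type*)
    [∀ q, TopologicalSpace (N q)] [∀ q, T2Space (N q)] [∀ q, CompactSpace (N q)]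
    [∀ q, Nonempty (N q)] [∀ q, ChartedSpace (EuclideanSpace ℝ (Fin (m q))) (N q)]
    [∀ q, IsManifold (𝓡 (m q)) ∞ (N q)] [∀ q, MeasurableSpace (N q)] [∀ q, BorelSpace (N q)]
    (g : ∀ q, WarpedIso.RiemMetric (m q) (N q)) (lam : EReal) (s : Fin p → ℝ → ℝ)
    (hs : ∀ q, ContinuousOn (s q) (WarpedIso.radii lam))
    (hs_nonneg : ∀ q, ∀ r ∈ WarpedIso.radii lam, 0 ≤ s q r)
    (hA : ∀ r ∈ WarpedIso.radii lam, 0 < r → 0 < WarpedIso.areaFactor m s r) :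
    -- the weighted inequality
    (∀ a c : ℝ → ℝ,
      (∀ r ∈ WarpedIso.radii lam, 0 < r → 0 < a r) →
      (∀ r ∈ WarpedIso.radii lam, 0 < r → 0 < c r) →
      (∀ r ∈ WarpedIso.radii lam,
        IntervalIntegrable (fun t => c t * WarpedIso.areaFactor m s t) volume 0 r) →
      WarpedIso.ConvexAlong lam (fun r => a r * WarpedIso.areaFactor m s r)
        (fun r => (WarpedIso.baseVolume g).real univ * WarpedIso.radialVolume m s c r) →
      WarpedIso.StarShapedIsoperimetric lam g s a c) ∧
    -- the case of the ordinary area and volume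
    (WarpedIso.ConvexAlong lam (WarpedIso.areaFactor m s)
        (WarpedIso.radialVolume m s fun _ => 1) →
      WarpedIso.StarShapedIsoperimetric lam g s (fun _ => 1) (fun _ => 1)) ∧
    -- the case of a single warping function that is twice differentiable
    (∀ σ : ℝ → ℝ, (∀ q, s q = σ) →
      (∀ r ∈ WarpedIso.radii lam, 0 < r →
        DifferentiableAt ℝ σ r ∧ DifferentiableAt ℝ (deriv σ) r) →
      ((0 < ∑ q, m q →
        (WarpedIso.ConvexAlong lam (WarpedIso.areaFactor m s)
            (WarpedIso.radialVolume m s fun _ => 1) ↔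
          ∀ r ∈ WarpedIso.radii lam, 0 < r →
            0 ≤ σ r * deriv (deriv σ) r - deriv σ r ^ 2)) ∧
      ((∀ r ∈ WarpedIso.radii lam, 0 < r →
          0 ≤ σ r * deriv (deriv σ) r - deriv σ r ^ 2) →
        WarpedIso.StarShapedIsoperimetric lam g s (fun _ => 1) (fun _ => 1)))) := by
  have : ∀ q, SecondCountableTopology (N q) := fun q =>
    ChartedSpace.secondCountable_of_sigmaCompact (EuclideanSpace ℝ (Fin (m q))) (N q)
  refine ⟨fun a c ha hc hint hconv =>
      WarpedIso.starShapedIsoperimetric_of_convexAlong g hs hs_nonneg hA ha hc hint hconv,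
    fun hconv => WarpedIso.starShapedIsoperimetric_one_of_convexAlong g hs hs_nonneg hA hconv,
    fun σ hsσ hd => ⟨fun hm => WarpedIso.convexAlong_areaFactor_iff hs hs_nonneg hA hsσ hd hm,
      fun hσ => WarpedIso.starShapedIsoperimetric_one_of_logConvex g hs hs_nonneg hA hsσ hd hσ⟩⟩
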